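/- Let $A=\{a^{(1)},\dots,a^{(N)}\}\subseteq\mathbb Z^n$, $a^{(j)}=(a^{(j)}_1,\dots,a^{(j)}_n)$, be lattice points that generate $\mathbb Z^n$ as an abelian group, and let $L=\{l\in\mathbb Z^N\mid\sum_j l_ja^{(j)}=0\}$. Let $\mathcal D=\mathbb C\langle\lambda_1,\dots,\lambda_N,\partial_1,\dots,\partial_N\rangle$ be the Weyl algebra ($\partial_j=\partial/\partial\lambda_j$), and for $\beta\in\mathbb C^n$ let $$\mathcal M_\beta=\mathcal D\Big/\Big(\sum_{l\in L}\mathcal D\,\Box_l+\sum_{i=1}^n\mathcal D\,Z_{i,\beta}\Big),\qquad \Box_l=\prod_{l_j>0}\partial_j^{l_j}-\prod_{l_j<0}\partial_j^{-l_j},\qquad Z_{i,\beta}=\sum_{j=1}^N a^{(j)}_i\lambda_j\partial_j-\beta_i$$ be the $A$-hypergeometric left $\mathcal D$-module. Let $\mathbb C[\lambda]=\mathbb C[\lambda_1,\dots,\lambda_N]$, $R'=\mathbb C[\lambda][x_1^{\pm1},\dots,x_n^{\pm1}]$ and $f=\sum_{j=1}^N\lambda_jx^{a^{(j)}}\in R'$.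 For $\alpha\in\mathbb C^n$ let $(\Omega^\bullet_{R'/\mathbb C[\lambda]},\nabla_\alpha)$ be the complex of relative differential forms with $$\nabla_\alpha(\omega)=d\omega+\sum_{i=1}^n\alpha_i\frac{dx_i}{x_i}\wedge\omega+df\wedge\omega .$$ It is a complex of left $\mathcal D$-modules: $\mathcal D$ acts on the coefficients of a form with respect to the $R'$-basis $\frac{dx_{i_1}}{x_{i_1}}\wedge\cdots\wedge\frac{dx_{i_k}}{x_{i_k}}$ ($i_1<\cdots<i_k$), where $\lambda_j$ acts on $R'$ by multiplication and $\partial_j$ acts on $R'$ as $\frac{\partial}{\partial\lambda_j}+x^{a^{(j)}}$. Let $C(A)\subseteq\mathbb R^n$ be the real cone generated by $A$, and let $\ell_1,\dots,\ell_s$ be the homogeneous linear forms with relatively prime integer coefficients that are nonnegative on $C(A)$ and define its codimension-one faces. Suppose that $\alpha$ is nonresonant for $A$, i.e. $\ell_i(\alpha)\notin\mathbb Z$ for all $i$. Then $$\mathcal M_{-\alpha}\;\cong\;H^n(\Omega^\bullet_{R'/\mathbb C[\lambda]},\nabla_\alpha)$$ as left $\mathcal D$-modules. (Equivalently, since nonresonance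 is invariant under $\alpha\mapsto-\alpha$: $\mathcal M_\alpha\cong H^n(\Omega^\bullet_{R'/\mathbb C[\lambda]},\nabla_{-\alpha})$ for every nonresonant $\alpha$.) -/

import Mathlib

open scoped KaehlerDifferential

noncomputable section

namespace AHypergeometric

/-! ### The Weyl algebra -/

/-- The defining relations of the Weyl algebra on the generators `λ_j` (`Sum.inl j`) and
`∂_j` (`Sum.inr j`). -/
inductive WeylRel (N : ℕ) :
    FreeAlgebra ℂ (Fin N ⊕ Fin N) → FreeAlgebra ℂ (Fin N ⊕ Fin N) → Prop
  | coord_comm (i j : Fin N) : WeylRel N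
      (FreeAlgebra.ι ℂ (Sum.inl i) * FreeAlgebra.ι ℂ (Sum.inl j))
      (FreeAlgebra.ι ℂ (Sum.inl j) * FreeAlgebra.ι ℂ (Sum.inl i))
  | partial_comm (i j : Fin N) : WeylRel N
      (FreeAlgebra.ι ℂ (Sum.inr i) * FreeAlgebra.ι ℂ (Sum.inr j))
      (FreeAlgebra.ι ℂ (Sum.inr j) * FreeAlgebra.ι ℂ (Sum.inr i))
  | partial_coord (i j : Fin N) : WeylRel N
      (FreeAlgebra.ι ℂ (Sum.inr i) * FreeAlgebra.ι ℂ (Sum.inl j))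
      (FreeAlgebra.ι ℂ (Sum.inl j) * FreeAlgebra.ι ℂ (Sum.inr i) + if i = j then 1 else 0)

/-- The Weyl algebra `𝒟 = ℂ⟨λ_1,…,λ_N,∂_1,…,∂_N⟩`. -/
abbrev Weyl (N : ℕ) : Type := RingQuot (WeylRel N)

/-- The element `λ_j` of the Weyl algebra. -/
def Weyl.coord {N : ℕ} (j : Fin N) : Weyl N :=
  RingQuot.mkAlgHom ℂ (WeylRel N) (FreeAlgebra.ι ℂ (Sum.inl j))

/-- The element `∂_j = ∂/∂λ_j` of the Weyl algebra. -/
def Weyl.partial {N : ℕ} (j : Fin N) : Weyl N :=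
  RingQuot.mkAlgHom ℂ (WeylRel N) (FreeAlgebra.ι ℂ (Sum.inr j))

/-! ### The hypergeometric module -/

variable {n N : ℕ}

/-- The box operator `∏_{l_j > 0} ∂_j^{l_j} - ∏_{l_j < 0} ∂_j^{-l_j}`. -/
def box (l : Fin N → ℤ) : Weyl N :=
  (List.ofFn fun j => Weyl.partial j ^ (l j).toNat).prod -
    (List.ofFn fun j => Weyl.partial j ^ (-l j).toNat).prod

/-- The Euler operator `Z_{i,α} = ∑_j a^{(j)}_i λ_j ∂_j - α_i`. -/
def eulerOp (a : Fin N → Fin n → ℤ) (α : Fin n → ℂ) (i : Fin n) : Weyl N :=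
  ∑ j, (a j i : Weyl N) * (Weyl.coord j * Weyl.partial j) - algebraMap ℂ (Weyl N) (α i)

/-- The lattice `L` of relations among the `a^{(j)}`. -/
def relationLattice (a : Fin N → Fin n → ℤ) : Set (Fin N → ℤ) :=
  {l | ∑ j, l j • a j = 0}

/-- The left ideal `∑_{l ∈ L} 𝒟 □_l + ∑_i 𝒟 Z_{i,α}`. -/
def hypergeometricIdeal (a : Fin N → Fin n → ℤ) (α : Fin n → ℂ) : Submodule (Weyl N) (Weyl N) :=
  Submodule.span (Weyl N) (box '' relationLattice a ∪ Set.range (eulerOp a α))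

/-- The `A`-hypergeometric module `ℳ_α`, a left `𝒟`-module. -/
abbrev HypergeometricModule (a : Fin N → Fin n → ℤ) (α : Fin n → ℂ) : Type :=
  Weyl N ⧸ hypergeometricIdeal a α

/-! ### Nonresonance -/

/-- The real cone `C(A)` generated by the `a^{(j)}`. -/
def cone (a : Fin N → Fin n → ℤ) : PointedCone ℝ (Fin n → ℝ) :=
  PointedCone.hull ℝ (Set.range fun j i => (a j i : ℝ))

/-- The integral linear form with coefficients `c` is one of the normalized forms that define the
codimension-one faces of `C(A)`: its coefficients are relatively prime, it is nonnegative on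
`C(A)`, and its zeros on `C(A)` form a face of dimension `n - 1`. -/
structure IsFacetForm (a : Fin N → Fin n → ℤ) (c : Fin n → ℤ) : Prop where
  gcd_eq_one : Finset.univ.gcd c = 1
  nonneg : ∀ u ∈ cone a, 0 ≤ ∑ i, (c i : ℝ) * u i
  codim_one : Module.finrank ℝ
    (Submodule.span ℝ {u : Fin n → ℝ | u ∈ cone a ∧ ∑ i, (c i : ℝ) * u i = 0}) + 1 = n

/-- `α` is nonresonant for `A`: no facet form takes an integral value at `α`. -/
def Nonresonant (a : Fin N → Fin n → ℤ) (α : Fin n → ℂ) : Prop :=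
  ∀ c : Fin n → ℤ, IsFacetForm a c → ∀ m : ℤ, ∑ i, (c i : ℂ) * α i ≠ m

/-! ### The coordinate ring of the torus -/

/-- `ℂ[λ] = ℂ[λ_1,…,λ_N]`. -/
abbrev Params (N : ℕ) : Type := MvPolynomial (Fin N) ℂ

/-- `R' = ℂ[λ][x_1^{±1},…,x_n^{±1}]`, the Laurent polynomial ring over `ℂ[λ]`. -/
def Torus (n N : ℕ) : Type := AddMonoidAlgebra (Params N) (Fin n → ℤ)

instance : CommRing (Torus n N) :=
  inferInstanceAs (CommRing (AddMonoidAlgebra (Params N) (Fin n → ℤ)))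

instance : Algebra (Params N) (Torus n N) :=
  inferInstanceAs (Algebra (Params N) (AddMonoidAlgebra (Params N) (Fin n → ℤ)))

instance : Algebra ℂ (Torus n N) :=
  inferInstanceAs (Algebra ℂ (AddMonoidAlgebra (Params N) (Fin n → ℤ)))

instance : IsScalarTower ℂ (Params N) (Torus n N) :=
  inferInstanceAs (IsScalarTower ℂ (Params N) (AddMonoidAlgebra (Params N) (Fin n → ℤ)))

/-- The coefficients of a Laurent polynomial. -/
def coeffs : Torus n N ≃ₗ[Params N] ((Fin n → ℤ) →₀ Params N) :=
  AddMonoidAlgebra.coeffLinearEquiv (Params N)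

/-- The Laurent monomial `x^u`. -/
def mono (u : Fin n → ℤ) : Torus n N := AddMonoidAlgebra.single u (1 : Params N)

/-- `f = ∑_j λ_j x^{a^{(j)}}`. -/
def genericPoly (a : Fin N → Fin n → ℤ) : Torus n N :=
  ∑ j, (MvPolynomial.X j : Params N) • mono (a j)

theorem coeffs_mono (u : Fin n → ℤ) : coeffs (mono u : Torus n N) = Finsupp.single u 1 := rfl

theorem coeffs_symm_single (u : Fin n → ℤ) (p : Params N) :
    coeffs.symm (Finsupp.single u p) = p • (mono u : Torus n N) := by
  rw [LinearEquiv.symm_apply_eq, map_smul, coeffs_mono, Finsupp.smul_single, smul_eq_mul, mul_one]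

theorem mono_mul (u v : Fin n → ℤ) : (mono u * mono v : Torus n N) = mono (u + v) :=
  (AddMonoidAlgebra.single_mul_single (R := Params N) u v 1 1).trans (by rw [one_mul]; rfl)

theorem mono_zero : (mono 0 : Torus n N) = 1 := rfl

theorem torus_induction {p : Torus n N → Prop} (r : Torus n N) (zero : p 0)
    (add : ∀ r s, p r → p s → p (r + s))
    (term : ∀ (c : Params N) (u : Fin n → ℤ), p (c • mono u)) : p r := by
  rw [← coeffs.symm_apply_apply r]
  induction coeffs r using Finsupp.induction_linear with
  | zero => rwa [map_zero]
  | add f g hf hg => rw [map_add]; exact add _ _ hf hg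
  | single u c => rw [coeffs_symm_single]; exact term c u

/-- The linear map `x^u ↦ u_i x^u` over `ℂ[λ]`. -/
def eulerLin (i : Fin n) : Torus n N →ₗ[Params N] Torus n N :=
  coeffs.symm.toLinearMap ∘ₗ
    Finsupp.lsum (Params N) (fun u : Fin n → ℤ => (u i : Params N) • Finsupp.lsingle u) ∘ₗ
      coeffs.toLinearMap

theorem eulerLin_term (i : Fin n) (c : Params N) (u : Fin n → ℤ) :
    eulerLin i (c • mono u : Torus n N) = (c * (u i : Params N)) • mono u := by
  rw [map_smul, mul_smul]
  congr 1
  simp [eulerLin, coeffs_mono, coeffs_symm_single]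

/-- The derivation `x_i ∂/∂x_i` of `R'` over `ℂ[λ]`. -/
def theta (i : Fin n) : Derivation (Params N) (Torus n N) (Torus n N) :=
  Derivation.mk' (eulerLin i) fun r s => by
    induction r using torus_induction with
    | zero => simp
    | add r r' h h' => simp only [add_mul, map_add, h, h', smul_eq_mul, mul_add]; ring
    | term c u =>
      induction s using torus_induction with
      | zero => simp
      | add r r' h h' => simp only [mul_add, map_add, h, h', smul_eq_mul, add_mul]; ring
      | term d v =>
        simp only [smul_mul_smul_comm, mono_mul, eulerLin_term, smul_eq_mul, ← add_smul,
          Pi.add_apply, Int.cast_add, add_comm v u]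
        congr 1; ring

theorem theta_term (i : Fin n) (c : Params N) (u : Fin n → ℤ) :
    theta i (c • mono u : Torus n N) = (c * (u i : Params N)) • mono u :=
  eulerLin_term i c u

/-- The operator `∂_j = ∂/∂λ_j` on `R'`, acting on coefficients. -/
def paramDeriv (j : Fin N) : Module.End ℂ (Torus n N) :=
  (coeffs.symm.restrictScalars ℂ).toLinearMap ∘ₗ
    Finsupp.mapRange.linearMap
      (MvPolynomial.pderiv j : Derivation ℂ (Params N) (Params N)).toLinearMap ∘ₗ
        (coeffs.restrictScalars ℂ).toLinearMap

theorem paramDeriv_term (j : Fin N) (c : Params N) (u : Fin n → ℤ) :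
    paramDeriv j (c • mono u : Torus n N) = MvPolynomial.pderiv j c • mono u := by
  simp [paramDeriv, coeffs_mono, coeffs_symm_single]

theorem paramDeriv_mul (j : Fin N) (r s : Torus n N) :
    paramDeriv j (r * s) = paramDeriv j r * s + r * paramDeriv j s := by
  induction r using torus_induction with
  | zero => simp
  | add r r' h h' => simp only [add_mul, map_add, h, h']; ring
  | term c u =>
    induction s using torus_induction with
    | zero => simp
    | add r r' h h' => simp only [mul_add, map_add, h, h']; ring
    | term d v =>
      simp only [smul_mul_smul_comm, mono_mul, paramDeriv_term, ← add_smul, Derivation.leibniz,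
        smul_eq_mul]
      rw [add_comm, mul_comm d]

/-! ### The action of the Weyl algebra on `R'` -/

/-- The operator `D_j = ∂_j + x^{a^{(j)}}` on `R'`. -/
def twistedPartial (a : Fin N → Fin n → ℤ) (j : Fin N) : Module.End ℂ (Torus n N) :=
  paramDeriv j + LinearMap.mulLeft ℂ (mono (a j))

/-- Multiplication by `λ_j` on `R'`. -/
def coordMul (j : Fin N) : Module.End ℂ (Torus n N) :=
  LinearMap.mulLeft ℂ (algebraMap (Params N) (Torus n N) (MvPolynomial.X j))

theorem end_ext {S T : Module.End ℂ (Torus n N)}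
    (h : ∀ (c : Params N) (u : Fin n → ℤ), S (c • mono u) = T (c • mono u)) : S = T := by
  refine LinearMap.ext fun r => ?_
  induction r using torus_induction with
  | zero => simp
  | add r s hr hs => rw [map_add, map_add, hr, hs]
  | term c u => exact h c u

theorem coordMul_term (j : Fin N) (c : Params N) (u : Fin n → ℤ) :
    coordMul j (c • mono u : Torus n N) = (MvPolynomial.X j * c) • mono u := by
  rw [coordMul, LinearMap.mulLeft_apply, ← Algebra.smul_def, smul_smul]

theorem twistedPartial_term (a : Fin N → Fin n → ℤ) (j : Fin N) (c : Params N) (u : Fin n → ℤ) :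
    twistedPartial a j (c • mono u) =
      MvPolynomial.pderiv j c • mono u + c • mono (u + a j) := by
  simp [twistedPartial, paramDeriv_term, mono_mul, add_comm (a j) u]

theorem pderiv_comm (i j : Fin N) (c : Params N) :
    MvPolynomial.pderiv i (MvPolynomial.pderiv j c) =
      MvPolynomial.pderiv j (MvPolynomial.pderiv i c) := by
  have h : ⁅(MvPolynomial.pderiv i : Derivation ℂ (Params N) (Params N)),
      (MvPolynomial.pderiv j : Derivation ℂ (Params N) (Params N))⁆ = 0 := by
    apply MvPolynomial.derivation_ext
    intro k
    rw [Derivation.commutator_apply, MvPolynomial.pderiv_X, MvPolynomial.pderiv_X]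
    simp only [Pi.single_apply, apply_ite, map_zero, Derivation.map_one_eq_zero, ite_self, sub_self,
      Derivation.zero_apply]
  have := congrArg (fun D => D c) h
  simpa [Derivation.commutator_apply, sub_eq_zero] using this

/-- The action of the Weyl algebra on `R'`, in which `λ_j` acts by multiplication and `∂_j` acts as
`D_j = ∂_j + x^{a^{(j)}}`. -/
def weylAction (a : Fin N → Fin n → ℤ) : Weyl N →ₐ[ℂ] Module.End ℂ (Torus n N) :=
  RingQuot.liftAlgHom ℂ ⟨FreeAlgebra.lift ℂ (Sum.elim coordMul (twistedPartial a)), by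
    intro x y h
    cases h with
    | coord_comm i j =>
      apply end_ext; intro c u
      simp [coordMul_term, mul_left_comm]
    | partial_comm i j =>
      apply end_ext; intro c u
      simp only [map_mul, FreeAlgebra.lift_ι_apply, Sum.elim_inr, Module.End.mul_apply,
        twistedPartial_term, map_add, pderiv_comm i j, add_right_comm u (a i) (a j)]
      abel
    | partial_coord i j =>
      apply end_ext; intro c u
      have key : MvPolynomial.pderiv i (MvPolynomial.X j * c) =
          MvPolynomial.X j * MvPolynomial.pderiv i c + if i = j then c else 0 := by
        rw [Derivation.leibniz, MvPolynomial.pderiv_X, Pi.single_apply]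
        by_cases hij : i = j
        · simp [hij]
        · simp [hij, Ne.symm hij]
      have one : ((if i = j then 1 else 0 : Module.End ℂ (Torus n N)) (c • mono u)) =
          (if i = j then c else 0) • mono u := by
        split_ifs <;> simp
      rw [map_mul, map_add, map_mul, apply_ite (FreeAlgebra.lift ℂ _), map_one, map_zero]
      simp only [FreeAlgebra.lift_ι_apply, Sum.elim_inr, Sum.elim_inl, Module.End.mul_apply,
        LinearMap.add_apply, twistedPartial_term, coordMul_term, map_add, key, one, add_smul]
      abel⟩

theorem weylAction_coord (a : Fin N → Fin n → ℤ) (j : Fin N) :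
    weylAction a (Weyl.coord j) = coordMul j := by
  simp [weylAction, Weyl.coord]

theorem weylAction_partial (a : Fin N → Fin n → ℤ) (j : Fin N) :
    weylAction a (Weyl.partial j) = twistedPartial a j := by
  simp [weylAction, Weyl.partial]

/-! ### Relative differential forms -/

/-- The module `Ω^1` of relative Kähler differentials of `R'` over `ℂ[λ]`. -/
abbrev OneForms (n N : ℕ) : Type := Ω[Torus n N⁄Params N]

/-- The universal derivation `d : R' → Ω^1`. -/
abbrev dOne : Derivation (Params N) (Torus n N) (OneForms n N) :=
  KaehlerDifferential.D (Params N) (Torus n N)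

/-- The logarithmic form `dx_i / x_i`. -/
def dlog (i : Fin n) : OneForms n N :=
  (mono (-Pi.single i 1) : Torus n N) • dOne (mono (Pi.single i 1))

theorem mono_smul_dOne_add (u v : Fin n → ℤ) :
    ((mono (-(u + v)) : Torus n N) • dOne (mono (u + v)) : OneForms n N) =
      (mono (-u) : Torus n N) • dOne (mono u) + (mono (-v) : Torus n N) • dOne (mono v) := by
  rw [← mono_mul u v, Derivation.leibniz, smul_add, smul_smul, smul_smul, mono_mul, mono_mul,
    add_comm]
  congr 3 <;> abel_nf

/-- The homomorphism `u ↦ x^{-u} d(x^u)`. -/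
def dlogHom : (Fin n → ℤ) →+ OneForms n N where
  toFun u := (mono (-u) : Torus n N) • dOne (mono u)
  map_zero' := by simp [mono_zero]
  map_add' := mono_smul_dOne_add

theorem dlogHom_eq (u : Fin n → ℤ) :
    (dlogHom u : OneForms n N) = ∑ i, u i • dlog i := by
  conv_lhs => rw [← Finset.univ_sum_single u]
  rw [map_sum]
  refine Finset.sum_congr rfl fun i _ => ?_
  have : (Pi.single i (u i) : Fin n → ℤ) = u i • Pi.single i 1 := by
    rw [← Pi.single_smul]; simp
  rw [this, map_zsmul]
  rfl

theorem dOne_mono (u : Fin n → ℤ) :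
    (dOne (mono u) : OneForms n N) = ∑ i, (u i • mono u : Torus n N) • dlog i := by
  have : (dOne (mono u) : OneForms n N) = (mono u : Torus n N) • dlogHom u := by
    simp [dlogHom, smul_smul, mono_mul, mono_zero]
  rw [this, dlogHom_eq, Finset.smul_sum]
  refine Finset.sum_congr rfl fun i _ => ?_
  rw [smul_assoc, smul_comm]

theorem dOne_eq (r : Torus n N) : (dOne r : OneForms n N) = ∑ i, theta i r • dlog i := by
  induction r using torus_induction with
  | zero => simp
  | add r s hr hs => simp [hr, hs, add_smul, Finset.sum_add_distrib]
  | term c u =>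
    rw [Derivation.map_smul, dOne_mono, Finset.smul_sum]
    refine Finset.sum_congr rfl fun i _ => ?_
    rw [theta_term, mul_smul, smul_assoc c, ← Int.cast_smul_eq_zsmul (Params N)]

/-- The derivation `r ↦ (x_i ∂r/∂x_i)_i`. -/
def thetaPi : Derivation (Params N) (Torus n N) (Fin n → Torus n N) :=
  Derivation.mk' (LinearMap.pi fun i => (theta i).toLinearMap) fun r s => by
    ext i : 1
    simp

/-- The coordinates of a one-form in terms of the `dx_i / x_i`. -/
def oneFormsEquiv : OneForms n N ≃ₗ[Torus n N] (Fin n → Torus n N) :=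
  LinearEquiv.ofLinearMap thetaPi.liftKaehlerDifferential
    (Fintype.linearCombination (Torus n N) dlog)
    (by
      refine LinearMap.pi_ext' fun i => LinearMap.ext_ring ?_
      ext j : 1
      have := theta_term (N := N) j 1 (Pi.single i 1)
      simp only [one_smul, one_mul] at this
      simp [Fintype.linearCombination_apply_single, dlog, thetaPi, this, mono_mul, mono_zero,
        Pi.single_apply])
    (by
      apply Derivation.liftKaehlerDifferential_unique
      ext r
      change Fintype.linearCombination (Torus n N) dlog
        (thetaPi.liftKaehlerDifferential (dOne r)) = dOne r
      rw [Derivation.liftKaehlerDifferential_comp_D, Fintype.linearCombination_apply, dOne_eq]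
      rfl)

/-- The basis `dx_i / x_i` of `Ω^1`. -/
def dlogBasis : Module.Basis (Fin n) (Torus n N) (OneForms n N) :=
  Module.Basis.ofEquivFun oneFormsEquiv

theorem dlogBasis_apply (i : Fin n) : (dlogBasis i : OneForms n N) = dlog i := by
  simp [dlogBasis, oneFormsEquiv, Fintype.linearCombination_apply_single]

section Wedge

variable {R M : Type*} [CommRing R] [AddCommGroup M] [Module R M]

/-- Exterior multiplication `ω ↦ η ∧ ω` by `η ∈ M`, from `⋀^k M` to `⋀^{k+1} M`. -/
def wedge (k : ℕ) (η : M) : ⋀[R]^k M →ₗ[R] ⋀[R]^(k + 1) M :=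
  ((LinearMap.mulLeft R (ExteriorAlgebra.ι R η)).comp (Submodule.subtype _)).codRestrict _
    fun ω => by
      rw [ExteriorAlgebra.exteriorPower, pow_succ']
      exact Submodule.mul_mem_mul (LinearMap.mem_range_self _ η) ω.2

theorem coe_wedge (k : ℕ) (η : M) (ω : ⋀[R]^k M) :
    (wedge k η ω : ExteriorAlgebra R M) = ExteriorAlgebra.ι R η * ω := rfl

theorem wedge_add (k : ℕ) (η η' : M) (ω : ⋀[R]^k M) :
    wedge k (η + η') ω = wedge k η ω + wedge k η' ω := by
  apply Subtype.ext; simp [coe_wedge, add_mul]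

theorem wedge_sum_smul (k : ℕ) {ι : Type*} (s : Finset ι) (r : ι → R) (η : ι → M)
    (ω : ⋀[R]^k M) :
    wedge k (∑ i ∈ s, r i • η i) ω = ∑ i ∈ s, wedge k (η i) (r i • ω) := by
  apply Subtype.ext; simp [coe_wedge, Finset.sum_mul]

theorem wedge_ιMulti (k : ℕ) (η : M) (v : Fin k → M) :
    wedge k η (exteriorPower.ιMulti R k v) =
      exteriorPower.ιMulti R (k + 1) (Fin.cons η v : Fin (k + 1) → M) := by
  apply Subtype.ext
  simp [coe_wedge, ExteriorAlgebra.ιMulti_succ_apply, Matrix.vecTail, Function.comp_def]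

theorem wedge_wedge_swap (k : ℕ) (η η' : M) (ω : ⋀[R]^k M) :
    wedge (k + 1) η (wedge k η' ω) = -wedge (k + 1) η' (wedge k η ω) := by
  apply Subtype.ext
  simp only [coe_wedge, Submodule.coe_neg, ← mul_assoc, ← neg_mul]
  congr 1
  rw [neg_mul, eq_neg_iff_add_eq_zero]
  exact ExteriorAlgebra.ι_add_mul_swap η η'

end Wedge

/-- The module `Ω^k` of relative `k`-forms of `R'` over `ℂ[λ]`. It depends on `A` only through the
action of the Weyl algebra defined below. -/
def Form (_a : Fin N → Fin n → ℤ) (k : ℕ) : Type := ⋀[Torus n N]^k (OneForms n N)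

variable (a : Fin N → Fin n → ℤ) (α : Fin n → ℂ) (k : ℕ)

instance : AddCommGroup (Form a k) :=
  inferInstanceAs (AddCommGroup (⋀[Torus n N]^k (OneForms n N)))

instance : Module (Torus n N) (Form a k) :=
  inferInstanceAs (Module (Torus n N) (⋀[Torus n N]^k (OneForms n N)))

/-- The basis `dx_{i_1}/x_{i_1} ∧ ⋯ ∧ dx_{i_k}/x_{i_k}`, `i_1 < ⋯ < i_k`, of `Ω^k` over `R'`. -/
def formBasis : Module.Basis (Set.powersetCard (Fin n) k) (Torus n N) (Form a k) :=
  dlogBasis.exteriorPower k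

/-- The map `ω ↦ η ∧ ω` from `Ω^k` to `Ω^{k+1}`, for a one-form `η`. -/
def formWedge (η : OneForms n N) : Form a k →ₗ[Torus n N] Form a (k + 1) :=
  wedge k η

/-- The exterior derivative `d(∑_I ξ_I e_I) = ∑_I dξ_I ∧ e_I`, where the `e_I` are the exterior
products of the closed forms `dx_i/x_i`. -/
def extDeriv : Form a k →+ Form a (k + 1) where
  toFun ω := ∑ I, formWedge a k (dOne ((formBasis a k).repr ω I)) (formBasis a k I)
  map_zero' := by
    refine Finset.sum_eq_zero fun I _ => ?_
    rw [map_zero, Finsupp.zero_apply]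
    apply Subtype.ext
    change ExteriorAlgebra.ι (Torus n N) (dOne (0 : Torus n N)) * _ = 0
    rw [map_zero, map_zero, zero_mul]
  map_add' ω ω' := by
    rw [← Finset.sum_add_distrib]
    refine Finset.sum_congr rfl fun I _ => ?_
    rw [map_add, Finsupp.add_apply, map_add]
    exact wedge_add _ _ _ _

/-- The one-form `∑_i α_i dx_i/x_i + df`. -/
def twistForm : OneForms n N :=
  ∑ i, algebraMap ℂ (Torus n N) (α i) • dlog i + dOne (genericPoly a)

/-- The twisted differential `∇_α ω = dω + ∑_i α_i dx_i/x_i ∧ ω + df ∧ ω`. -/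
def nablaHom : Form a k →+ Form a (k + 1) :=
  extDeriv a k + (formWedge a k (twistForm a α)).toAddMonoidHom

/-- The operator on `Ω^k` that applies `φ : R' → R'` to the coefficients with respect to the basis
`dx_{i_1}/x_{i_1} ∧ ⋯ ∧ dx_{i_k}/x_{i_k}`. -/
def coeffwise : Module.End ℂ (Torus n N) →+* AddMonoid.End (Form a k) where
  toFun φ :=
    { toFun := fun ω => ∑ I, φ ((formBasis a k).repr ω I) • formBasis a k I
      map_zero' := by simp
      map_add' := fun ω ω' => by simp [add_smul, Finset.sum_add_distrib] }
  map_one' := by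
    ext ω
    exact (formBasis a k).sum_repr ω
  map_mul' φ ψ := by
    ext ω
    change _ = ∑ I, φ ((formBasis a k).repr
      (∑ J, ψ ((formBasis a k).repr ω J) • formBasis a k J) I) • formBasis a k I
    simp only [Module.Basis.repr_sum_self]
    rfl
  map_zero' := by
    ext ω
    exact Finset.sum_eq_zero fun I _ => zero_smul _ _
  map_add' φ ψ := by
    ext ω
    refine Eq.trans ?_ (Finset.sum_add_distrib (s := Finset.univ)
      (f := fun I => φ ((formBasis a k).repr ω I) • formBasis a k I)
      (g := fun I => ψ ((formBasis a k).repr ω I) • formBasis a k I))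
    exact Finset.sum_congr rfl fun I _ => add_smul _ _ _

/-- The action of the Weyl algebra on `Ω^k` through the coefficients. -/
instance : Module (Weyl N) (Form a k) :=
  Module.compHom _ ((coeffwise a k).comp (weylAction a).toRingHom)

theorem coeffwise_mul_apply (φ ψ : Module.End ℂ (Torus n N)) (ω : Form a k) :
    coeffwise a k φ (coeffwise a k ψ ω) = coeffwise a k (φ * ψ) ω := by
  rw [map_mul]; rfl

theorem coeffwise_apply (φ : Module.End ℂ (Torus n N)) (ω : Form a k) :
    coeffwise a k φ ω = ∑ I, φ ((formBasis a k).repr ω I) • formBasis a k I := rfl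

theorem weyl_smul_def (P : Weyl N) (ω : Form a k) :
    P • ω = coeffwise a k (weylAction a P) ω := rfl

theorem formWedge_sum_smul {ι : Type*} (s : Finset ι) (r : ι → Torus n N)
    (η : ι → OneForms n N) (ω : Form a k) :
    formWedge a k (∑ i ∈ s, r i • η i) ω = ∑ i ∈ s, formWedge a k (η i) (r i • ω) :=
  wedge_sum_smul k s r η ω

/-- The operator `D_{i,α} = x_i ∂/∂x_i + α_i + x_i ∂f/∂x_i` on `R'`. -/
def twistedTheta (i : Fin n) : Module.End ℂ (Torus n N) :=
  (theta i).toLinearMap.restrictScalars ℂ +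
    LinearMap.mulLeft ℂ (algebraMap ℂ (Torus n N) (α i) + theta i (genericPoly a))

theorem twistForm_eq : twistForm a α =
    ∑ i, (algebraMap ℂ (Torus n N) (α i) + theta i (genericPoly a)) • dlog i := by
  simp only [twistForm, dOne_eq, add_smul, Finset.sum_add_distrib]

/-- In terms of the basis of logarithmic forms, `∇_α` is given by the operators `D_{i,α}`. -/
theorem nablaHom_eq (ω : Form a k) :
    nablaHom a α k ω =
      ∑ i, formWedge a k (dlog i) (coeffwise a k (twistedTheta a α i) ω) := by
  have h1 : extDeriv a k ω =
      ∑ i, formWedge a k (dlog i) (∑ I, theta i ((formBasis a k).repr ω I) • formBasis a k I) := by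
    change ∑ I, formWedge a k (dOne ((formBasis a k).repr ω I)) (formBasis a k I) = _
    simp only [dOne_eq, formWedge_sum_smul, map_sum]
    exact Finset.sum_comm
  have h2 : formWedge a k (twistForm a α) ω = ∑ i, formWedge a k (dlog i)
      ((algebraMap ℂ (Torus n N) (α i) + theta i (genericPoly a)) • ω) := by
    rw [twistForm_eq, formWedge_sum_smul]
  change extDeriv a k ω + formWedge a k (twistForm a α) ω = _
  rw [h1, h2, ← Finset.sum_add_distrib]
  refine Finset.sum_congr rfl fun i _ => ?_
  rw [← map_add]
  congr 1
  conv_lhs => enter [2]; rw [← (formBasis a k).sum_repr ω, Finset.smul_sum]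
  rw [← Finset.sum_add_distrib, coeffwise_apply]
  refine Finset.sum_congr rfl fun I _ => ?_
  rw [smul_smul, ← add_smul]
  rfl

/-- The exterior product of logarithmic forms has integral coefficients. -/
theorem repr_wedge_int (i : Fin n) (I : Set.powersetCard (Fin n) k)
    (J : Set.powersetCard (Fin n) (k + 1)) :
    ∃ m : ℤ, (formBasis a (k + 1)).repr (formWedge a k (dlog i) (formBasis a k I)) J = m := by
  let B : Module.Basis (Fin n) (Torus n N) (OneForms n N) := dlogBasis
  let v : Fin (k + 1) → Fin n := Fin.cons i (Set.powersetCard.ofFinEmbEquiv.symm I)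
  have hv : formWedge a k (dlog i) (formBasis a k I) =
      exteriorPower.ιMulti (Torus n N) (k + 1) (B ∘ v) := by
    change wedge k (dlog i) (B.exteriorPower k I) = _
    rw [exteriorPower.basis_apply, exteriorPower.ιMulti_family, wedge_ιMulti, ← dlogBasis_apply]
    congr 1
    ext j
    refine Fin.cases rfl (fun j => rfl) j
  refine ⟨(Matrix.of fun r s : Fin (k + 1) =>
    if v r = Set.powersetCard.ofFinEmbEquiv.symm J s then (1 : ℤ) else 0).det, ?_⟩
  rw [hv]
  change (B.exteriorPower (k + 1)).repr _ J = _
  rw [exteriorPower.basis_repr_apply, exteriorPower.ιMultiDual_apply_ιMulti, Int.cast_det]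
  congr 1
  ext r s
  simp [Finsupp.single_apply]

theorem coeffwise_wedge (φ : Module.End ℂ (Torus n N)) (i : Fin n) (ω : Form a k) :
    coeffwise a (k + 1) φ (formWedge a k (dlog i) ω) =
      formWedge a k (dlog i) (coeffwise a k φ ω) := by
  choose m hm using repr_wedge_int a k i
  rw [coeffwise_apply, coeffwise_apply, map_sum]
  have h1 : ∀ J, (formBasis a (k + 1)).repr (formWedge a k (dlog i) ω) J =
      ∑ I, m I J • (formBasis a k).repr ω I := fun J => by
    conv_lhs => rw [← (formBasis a k).sum_repr ω]
    simp only [map_sum, map_smul, Finsupp.coe_finsetSum, Finset.sum_apply, Finsupp.smul_apply, hm,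
      smul_eq_mul, zsmul_eq_mul]
    exact Finset.sum_congr rfl fun I _ => mul_comm _ _
  have h2 : ∀ I, formWedge a k (dlog i) (formBasis a k I) =
      ∑ J, (m I J : Torus n N) • formBasis a (k + 1) J := fun I => by
    rw [← (formBasis a (k + 1)).sum_repr (formWedge a k (dlog i) (formBasis a k I))]
    simp only [hm]
  simp only [h1, map_sum, map_zsmul, map_smul, h2, Finset.smul_sum, Finset.sum_smul]
  rw [Finset.sum_comm]
  refine Finset.sum_congr rfl fun I _ => Finset.sum_congr rfl fun J _ => ?_
  rw [smul_smul, mul_comm, ← zsmul_eq_mul]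

theorem twistedTheta_apply (i : Fin n) (r : Torus n N) : twistedTheta a α i r =
    theta i r + (algebraMap ℂ (Torus n N) (α i) + theta i (genericPoly a)) * r := rfl

theorem theta_algebraMap (i : Fin n) (z : ℂ) : theta i (algebraMap ℂ (Torus n N) z) = 0 := by
  rw [IsScalarTower.algebraMap_apply ℂ (Params N) (Torus n N), Derivation.map_algebraMap]

theorem theta_theta_comm (i j : Fin n) (r : Torus n N) :
    theta i (theta j r) = theta j (theta i r) := by
  induction r using torus_induction with
  | zero => simp
  | add r s hr hs => simp only [map_add, hr, hs]
  | term c u => simp only [theta_term]; rw [mul_right_comm]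

theorem theta_paramDeriv_comm (i : Fin n) (j : Fin N) (r : Torus n N) :
    theta i (paramDeriv j r) = paramDeriv j (theta i r) := by
  induction r using torus_induction with
  | zero => simp
  | add r s hr hs => simp only [map_add, hr, hs]
  | term c u =>
    simp only [theta_term, paramDeriv_term]
    have h0 : MvPolynomial.pderiv j (u i : Params N) = 0 := Derivation.map_intCast _ _
    rw [Derivation.leibniz, h0, smul_zero, zero_add, smul_eq_mul, mul_comm]

theorem paramDeriv_algebraMap (j : Fin N) (z : ℂ) :
    paramDeriv j (algebraMap ℂ (Torus n N) z) = 0 := by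
  have : algebraMap ℂ (Torus n N) z = (MvPolynomial.C z : Params N) • (mono 0 : Torus n N) := by
    rw [IsScalarTower.algebraMap_apply ℂ (Params N) (Torus n N), Algebra.algebraMap_eq_smul_one,
      mono_zero, MvPolynomial.algebraMap_eq]
  rw [this, paramDeriv_term, MvPolynomial.pderiv_C, zero_smul]

theorem paramDeriv_genericPoly (j : Fin N) :
    paramDeriv j (genericPoly a : Torus n N) = mono (a j) := by
  rw [genericPoly, map_sum, Finset.sum_eq_single j]
  · rw [paramDeriv_term, MvPolynomial.pderiv_X_self, one_smul]
  · intro m _ hm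
    rw [paramDeriv_term, MvPolynomial.pderiv_X_of_ne hm, zero_smul]
  · simp

theorem twistedTheta_comm (i j : Fin n) :
    Commute (twistedTheta a α i) (twistedTheta a α j) := by
  refine LinearMap.ext fun r => ?_
  simp only [Module.End.mul_apply, twistedTheta_apply, map_add, Derivation.leibniz,
    theta_algebraMap, smul_eq_mul, theta_theta_comm i j]
  ring

theorem twistedTheta_coordMul (i : Fin n) (j : Fin N) :
    Commute (twistedTheta a α i) (coordMul j) := by
  refine LinearMap.ext fun r => ?_
  simp only [Module.End.mul_apply, twistedTheta_apply, coordMul, LinearMap.mulLeft_apply,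
    Derivation.leibniz, Derivation.map_algebraMap, smul_eq_mul]
  ring

theorem twistedTheta_twistedPartial (i : Fin n) (j : Fin N) :
    Commute (twistedTheta a α i) (twistedPartial a j) := by
  refine LinearMap.ext fun r => ?_
  simp only [Module.End.mul_apply, twistedTheta_apply, twistedPartial, LinearMap.add_apply,
    LinearMap.mulLeft_apply, map_add, paramDeriv_mul, Derivation.leibniz, smul_eq_mul,
    paramDeriv_algebraMap, ← theta_paramDeriv_comm, paramDeriv_genericPoly]
  ring

theorem twistedTheta_weylAction (i : Fin n) (P : Weyl N) :
    Commute (twistedTheta a α i) (weylAction a P) := by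
  obtain ⟨P, rfl⟩ := RingQuot.mkAlgHom_surjective ℂ (WeylRel N) P
  induction P using FreeAlgebra.induction with
  | grade0 r => rw [AlgHom.commutes, AlgHom.commutes]; exact Algebra.commute_algebraMap_right _ _
  | grade1 x =>
    cases x with
    | inl j => exact (weylAction_coord a j).symm ▸ twistedTheta_coordMul a α i j
    | inr j => exact (weylAction_partial a j).symm ▸ twistedTheta_twistedPartial a α i j
  | mul x y hx hy => rw [map_mul, map_mul]; exact hx.mul_right hy
  | add x y hx hy => rw [map_add, map_add]; exact hx.add_right hy

/-- The twisted differential `∇_α` as a homomorphism of modules over the Weyl algebra. -/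
def nabla : Form a k →ₗ[Weyl N] Form a (k + 1) where
  toFun := nablaHom a α k
  map_add' := map_add _
  map_smul' P ω := by
    simp only [nablaHom_eq, weyl_smul_def, RingHom.id_apply, map_sum, coeffwise_wedge,
      coeffwise_mul_apply, (twistedTheta_weylAction a α _ P).eq]

theorem nabla_nabla (ω : Form a k) : nabla a α (k + 1) (nabla a α k ω) = 0 := by
  change nablaHom a α (k + 1) (nablaHom a α k ω) = 0
  rw [nablaHom_eq, nablaHom_eq]
  simp only [map_sum, coeffwise_wedge, coeffwise_mul_apply]
  let t : Fin n → Fin n → Form a (k + 2) := fun i j => formWedge a (k + 1) (dlog i)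
    (formWedge a k (dlog j) (coeffwise a k (twistedTheta a α i * twistedTheta a α j) ω))
  have hanti : ∀ i j, t i j + t j i = 0 := fun i j => by
    rw [add_eq_zero_iff_eq_neg]
    change _ = -formWedge a (k + 1) (dlog j) (formWedge a k (dlog i) _)
    rw [← (twistedTheta_comm a α i j).eq]
    exact wedge_wedge_swap k _ _ _
  have hdiag : ∀ i, t i i = 0 := fun i => by
    apply Subtype.ext
    change ExteriorAlgebra.ι (Torus n N) (dlog i) * (ExteriorAlgebra.ι (Torus n N) (dlog i) * _) = 0
    rw [← mul_assoc, ExteriorAlgebra.ι_sq_zero, zero_mul]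
  change ∑ i, ∑ j, t i j = 0
  rw [← Finset.sum_product']
  refine Finset.sum_involution (fun p _ => p.swap) (fun p _ => hanti _ _) ?_
    (fun _ _ => Finset.mem_univ _) (fun _ _ => Prod.swap_swap _)
  intro p _ hp h
  have : p.1 = p.2 := (congrArg Prod.fst h).symm
  exact hp (by rw [this]; exact hdiag _)

/-- The twisted relative de Rham complex `(Ω^•, ∇_α)`, a complex of modules over the Weyl
algebra. -/
def deRham : CochainComplex (ModuleCat.{0} (Weyl N)) ℕ :=
  CochainComplex.of (fun k => ModuleCat.of (Weyl N) (Form a k))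
    (fun k => ModuleCat.ofHom (nabla a α k)) fun k => by
      ext ω
      exact nabla_nabla a α k ω

end AHypergeometric

end

open scoped KaehlerDifferential

noncomputable section

namespace AHypergeometric

variable {n N : ℕ}

section

/-! ### Normal forms in the Weyl algebra -/

/-! Every n-form is a multiple r · dx_1/x_1 ∧ ⋯ ∧ dx_n/x_n. In this coordinate H^n is the cokernel
R'/∑_i D_{i,α} R', where D_{i,α} = x_i ∂/∂x_i + α_i + x_i ∂f/∂x_i commutes with the action of 𝒟. The
isomorphism is induced by P ↦ P · 1.

The source has the same shape. If P = ∑_q f_q ∂^q, then P · 1 records only the sums of the f_q over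
exponents q of equal weight ∑ q_j a^{(j)}; hence the annihilator of 1 is ∑ 𝒟 □_l
(`mem_boxIdeal_of_weylAction_one`). Moreover Z_{i,-α} · 1 = D_{i,α} · 1 (`weylAction_eulerOp_one`).
So ℳ_{-α} is V/∑_i D_{i,α} V for V = 𝒟 · 1, the ℂ[λ]-span of the monomials with exponents in the
semigroup ℕA.

It remains to compare V with R'. A product T of operators 1 - ∑ c_i D_{i,α} is the identity modulo
the images of the D_{i,α}, on V as well as on R' (`unipotents_sub_mem`). If every element of R' is
carried into V by some T (`absorbed_eq_top`), then V → R' induces a bijection of cokernels: r ≡ T r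
gives surjectivity, and applying one T to a relation P · 1 = ∑ D_{i,α} r_i moves the r_i into V,
which gives injectivity.

Nonresonance enters in `mono_mem_absorbed`. For a facet form c, the operator s⁻¹ ∑ c_i D_{i,α} with
s = c(α + u) ≠ 0 sends x^u to x^u + s⁻¹ ∑_j c(a^{(j)}) λ_j x^{u + a^{(j)}}, so x^u is absorbed once
the x^{u + a^{(j)}} with c(a^{(j)}) ≠ 0 are. A Noetherian argument (`exists_maximal_not_absorbed`),
with Farkas' lemma supplying the facet (`exists_isFacetForm`), excludes a monomial that is not
absorbed. -/

theorem Weyl.coord_mul_coord (i j : Fin N) :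
    (Weyl.coord i * Weyl.coord j : Weyl N) = Weyl.coord j * Weyl.coord i := by
  simp only [Weyl.coord, ← map_mul]
  exact RingQuot.mkAlgHom_rel ℂ (WeylRel.coord_comm i j)

theorem Weyl.partial_mul_partial (i j : Fin N) :
    (Weyl.partial i * Weyl.partial j : Weyl N) = Weyl.partial j * Weyl.partial i := by
  simp only [Weyl.partial, ← map_mul]
  exact RingQuot.mkAlgHom_rel ℂ (WeylRel.partial_comm i j)

theorem Weyl.partial_mul_coord (i j : Fin N) :
    (Weyl.partial i * Weyl.coord j : Weyl N) =
      Weyl.coord j * Weyl.partial i + if i = j then 1 else 0 := by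
  have := RingQuot.mkAlgHom_rel ℂ (WeylRel.partial_coord (N := N) i j)
  rw [map_mul, map_add, map_mul, apply_ite (RingQuot.mkAlgHom ℂ (WeylRel N)), map_one,
    map_zero] at this
  exact this

section CommutingFamily

variable {ι B : Type*} [Ring B] [Algebra ℂ B]

open scoped IsMulCommutative in
/-- Evaluation of polynomials at a commuting family of elements of a noncommutative algebra. -/
def commAeval (x : ι → B) (hx : ∀ i j, x i * x j = x j * x i) : MvPolynomial ι ℂ →ₐ[ℂ] B :=
  haveI : IsMulCommutative (Algebra.adjoin ℂ (Set.range x)) :=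
    Algebra.isMulCommutative_adjoin ℂ (by rintro _ ⟨i, rfl⟩ _ ⟨j, rfl⟩; exact hx i j)
  (Algebra.adjoin ℂ (Set.range x)).val.comp
    (MvPolynomial.aeval fun i => (⟨x i, Algebra.subset_adjoin ⟨i, rfl⟩⟩ :
      Algebra.adjoin ℂ (Set.range x)))

open scoped IsMulCommutative in
theorem commAeval_X (x : ι → B) (hx : ∀ i j, x i * x j = x j * x i) (i : ι) :
    commAeval x hx (MvPolynomial.X i) = x i := by
  simp [commAeval]

end CommutingFamily

/-- The subalgebra `ℂ[λ]` of the Weyl algebra. -/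
def Weyl.ofCoord : MvPolynomial (Fin N) ℂ →ₐ[ℂ] Weyl N :=
  commAeval Weyl.coord Weyl.coord_mul_coord

/-- The subalgebra `ℂ[∂]` of the Weyl algebra. -/
def Weyl.ofPartial : MvPolynomial (Fin N) ℂ →ₐ[ℂ] Weyl N :=
  commAeval Weyl.partial Weyl.partial_mul_partial

theorem Weyl.ofCoord_X (j : Fin N) : Weyl.ofCoord (MvPolynomial.X j) = Weyl.coord j :=
  commAeval_X _ _ j

theorem Weyl.ofPartial_X (j : Fin N) : Weyl.ofPartial (MvPolynomial.X j) = Weyl.partial j :=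
  commAeval_X _ _ j

theorem Weyl.partial_mul_ofCoord (j : Fin N) (f : Params N) :
    Weyl.partial j * Weyl.ofCoord f =
      Weyl.ofCoord f * Weyl.partial j + Weyl.ofCoord (MvPolynomial.pderiv j f) := by
  induction f using MvPolynomial.induction_on with
  | C z =>
    rw [MvPolynomial.pderiv_C, map_zero, add_zero, ← MvPolynomial.algebraMap_eq, AlgHom.commutes]
    exact (Algebra.commutes z _).symm
  | add f g hf hg => simp only [map_add, mul_add, add_mul, hf, hg]; abel
  | mul_X f i hf =>
    rw [map_mul, Weyl.ofCoord_X, ← mul_assoc, hf, add_mul, mul_assoc, Weyl.partial_mul_coord,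
      Derivation.leibniz, MvPolynomial.pderiv_X, map_add, mul_add, ← mul_assoc]
    rw [smul_eq_mul, smul_eq_mul, mul_comm (MvPolynomial.X i), map_mul, map_mul, Weyl.ofCoord_X]
    by_cases h : j = i
    · subst h; simp; abel
    · simp [h, Ne.symm h]

/-- The normally ordered operator `∑_q f_q ∂^q`. -/
def Weyl.normal : ((Fin N →₀ ℕ) →₀ Params N) →+ Weyl N :=
  Finsupp.liftAddHom fun q => (AddMonoidHom.mulRight
    (Weyl.ofPartial (MvPolynomial.monomial q 1))).comp (Weyl.ofCoord (N := N)).toAddMonoidHom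

theorem Weyl.normal_single (q : Fin N →₀ ℕ) (f : Params N) :
    Weyl.normal (Finsupp.single q f) =
      Weyl.ofCoord f * Weyl.ofPartial (MvPolynomial.monomial q 1) := by
  simp [Weyl.normal]

theorem Weyl.coord_mul_normal (j : Fin N) (h : (Fin N →₀ ℕ) →₀ Params N) :
    Weyl.coord j * Weyl.normal h ∈ Set.range (Weyl.normal (N := N)) := by
  rw [← AddMonoidHom.coe_range, SetLike.mem_coe]
  induction h using Finsupp.induction_linear with
  | zero => simp
  | add f g hf hg => rw [map_add, mul_add]; exact add_mem hf hg
  | single q f =>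
    refine ⟨Finsupp.single q (MvPolynomial.X j * f), ?_⟩
    rw [Weyl.normal_single, Weyl.normal_single, map_mul, Weyl.ofCoord_X, mul_assoc]

theorem Weyl.partial_mul_normal (j : Fin N) (h : (Fin N →₀ ℕ) →₀ Params N) :
    Weyl.partial j * Weyl.normal h ∈ Set.range (Weyl.normal (N := N)) := by
  rw [← AddMonoidHom.coe_range, SetLike.mem_coe]
  induction h using Finsupp.induction_linear with
  | zero => simp
  | add f g hf hg => rw [map_add, mul_add]; exact add_mem hf hg
  | single q f =>
    refine ⟨Finsupp.single (Finsupp.single j 1 + q) f +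
      Finsupp.single q (MvPolynomial.pderiv j f), ?_⟩
    rw [map_add, Weyl.normal_single, Weyl.normal_single, Weyl.normal_single, ← mul_assoc,
      Weyl.partial_mul_ofCoord, add_mul, mul_assoc, ← Weyl.ofPartial_X, ← map_mul,
      MvPolynomial.X, MvPolynomial.monomial_mul, one_mul]

/-- The normally ordered operators contain 1 and are stable under left multiplication by the
generators. Only this spanning half of the normal form theorem is needed, not uniqueness. -/
theorem Weyl.normal_surjective : Function.Surjective (Weyl.normal (N := N)) := by
  have key : ∀ P : FreeAlgebra ℂ (Fin N ⊕ Fin N), ∀ h : (Fin N →₀ ℕ) →₀ Params N,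
      RingQuot.mkAlgHom ℂ (WeylRel N) P * Weyl.normal h ∈ (Weyl.normal (N := N)).range := by
    intro P
    induction P using FreeAlgebra.induction with
    | grade0 z =>
      intro h
      rw [AlgHom.commutes]
      induction h using Finsupp.induction_linear with
      | zero => simp
      | add f g hf hg => rw [map_add, mul_add]; exact add_mem hf hg
      | single q f =>
        refine ⟨Finsupp.single q (MvPolynomial.C z * f), ?_⟩
        rw [Weyl.normal_single, Weyl.normal_single, map_mul, ← MvPolynomial.algebraMap_eq,
          AlgHom.commutes, mul_assoc]
    | grade1 x =>
      cases x with
      | inl j => exact Weyl.coord_mul_normal j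
      | inr j => exact Weyl.partial_mul_normal j
    | mul x y hx hy =>
      intro h
      obtain ⟨h', e⟩ := hy h
      rw [map_mul, mul_assoc, ← e]
      exact hx h'
    | add x y hx hy =>
      intro h
      rw [map_add, add_mul]
      exact add_mem (hx h) (hy h)
  intro P
  obtain ⟨P, rfl⟩ := RingQuot.mkAlgHom_surjective ℂ (WeylRel N) P
  have := key P (Finsupp.single 0 1)
  rwa [Weyl.normal_single, map_one, one_mul, ← MvPolynomial.one_def, map_one, mul_one] at this

/-! ### The annihilator of `1 ∈ R'` -/

variable (a : Fin N → Fin n → ℤ)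

/-- The weight `∑_j q_j a^{(j)}` of an exponent `q ∈ ℕ^N`. -/
def weight : (Fin N →₀ ℕ) →+ (Fin n → ℤ) :=
  Finsupp.liftAddHom fun j => (multiplesHom _) (a j)

theorem weight_single (j : Fin N) (m : ℕ) : weight a (Finsupp.single j m) = m • a j := by
  simp [weight]

theorem weight_eq_sum (q : Fin N →₀ ℕ) : weight a q = ∑ j, q j • a j := by
  simp [weight, Finsupp.sum_fintype]

theorem weylAction_ofCoord (f : Params N) (r : Torus n N) :
    weylAction a (Weyl.ofCoord f) r = f • r := by
  induction f using MvPolynomial.induction_on generalizing r with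
  | C z =>
    rw [← MvPolynomial.algebraMap_eq, AlgHom.commutes, AlgHom.commutes, Module.algebraMap_end_apply,
      algebraMap_smul]
  | add f g hf hg => simp only [map_add, LinearMap.add_apply, hf, hg, add_smul]
  | mul_X f i hf =>
    rw [map_mul, map_mul, Module.End.mul_apply, hf, Weyl.ofCoord_X, weylAction_coord, coordMul,
      LinearMap.mulLeft_apply, ← Algebra.smul_def, smul_smul]

theorem weylAction_partial_mono (j : Fin N) (u : Fin n → ℤ) :
    weylAction a (Weyl.partial j) (mono u) = mono (u + a j) := by
  have := twistedPartial_term a j 1 u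
  simpa [weylAction_partial] using this

theorem weylAction_ofPartial_monomial (q : Fin N →₀ ℕ) (u : Fin n → ℤ) :
    weylAction a (Weyl.ofPartial (MvPolynomial.monomial q 1)) (mono u) =
      mono (u + weight a q) := by
  induction q using Finsupp.induction_linear generalizing u with
  | zero => simp [← MvPolynomial.one_def]
  | add p q hp hq =>
    rw [← one_mul (1 : ℂ), ← MvPolynomial.monomial_mul, map_mul, map_mul, Module.End.mul_apply, hq,
      hp, map_add]
    congr 1; abel
  | single j m =>
    induction m generalizing u with
    | zero => simp [← MvPolynomial.one_def]
    | succ m ih =>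
      have : (MvPolynomial.monomial (Finsupp.single j (m + 1)) 1 : MvPolynomial (Fin N) ℂ) =
          MvPolynomial.monomial (Finsupp.single j m) 1 * MvPolynomial.X j := by
        rw [MvPolynomial.X, MvPolynomial.monomial_mul, one_mul, Finsupp.single_add]
      rw [this, map_mul, map_mul, Module.End.mul_apply, Weyl.ofPartial_X,
        weylAction_partial_mono, ih, weight_single, weight_single, add_smul, one_smul]
      congr 1; abel

/-- Since ∂^q sends 1 to the monomial whose exponent is the weight of q, the only information lost
is the distribution of the coefficients inside each fibre of the weight map. -/
theorem weylAction_normal_one (h : (Fin N →₀ ℕ) →₀ Params N) :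
    weylAction a (Weyl.normal h) 1 = coeffs.symm (h.mapDomain (weight a)) := by
  induction h using Finsupp.induction_linear with
  | zero => simp
  | add f g hf hg => simp only [map_add, LinearMap.add_apply, hf, hg, Finsupp.mapDomain_add]
  | single q f =>
    rw [Weyl.normal_single, map_mul, Module.End.mul_apply, ← mono_zero,
      weylAction_ofPartial_monomial, weylAction_ofCoord, Finsupp.mapDomain_single,
      coeffs_symm_single, zero_add]

theorem box_eq (l : Fin N → ℤ) : box l = Weyl.ofPartial
    (MvPolynomial.monomial (Finsupp.equivFunOnFinite.symm fun j => (l j).toNat) 1 -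
      MvPolynomial.monomial (Finsupp.equivFunOnFinite.symm fun j => (-l j).toNat) 1) := by
  have key : ∀ q : Fin N → ℕ, (List.ofFn fun j => Weyl.partial j ^ q j).prod =
      Weyl.ofPartial (MvPolynomial.monomial (Finsupp.equivFunOnFinite.symm q) 1) := by
    intro q
    rw [MvPolynomial.monomial_eq, map_one, one_mul, Finsupp.prod_fintype _ _ (by simp),
      ← List.prod_ofFn, map_list_prod, List.map_ofFn]
    congr 2
    ext j
    simp [Weyl.ofPartial_X]
  rw [box, key, key, ← map_sub]

/-- The left ideal `∑_{l ∈ L} 𝒟 □_l`. -/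
def boxIdeal : Submodule (Weyl N) (Weyl N) :=
  Submodule.span (Weyl N) (box '' relationLattice a)

/-- Splitting off the common factor ∂^{min(p, q)} leaves exactly the box operator of l = p - q,
which is a relation because the weights agree. -/
theorem ofPartial_sub_mem_boxIdeal (p q : Fin N →₀ ℕ) (h : weight a p = weight a q) :
    Weyl.ofPartial (MvPolynomial.monomial p 1 - MvPolynomial.monomial q 1) ∈ boxIdeal a := by
  let l : Fin N → ℤ := fun j => p j - q j
  have hl : l ∈ relationLattice a := by
    simp only [weight_eq_sum] at h
    simp only [relationLattice, Set.mem_ofPred_eq, l, sub_smul, Finset.sum_sub_distrib,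
      natCast_zsmul, h, sub_self]
  have e : (MvPolynomial.monomial p 1 - MvPolynomial.monomial q 1 : MvPolynomial (Fin N) ℂ) =
      MvPolynomial.monomial (p ⊓ q) 1 *
        (MvPolynomial.monomial (Finsupp.equivFunOnFinite.symm fun j => (l j).toNat) 1 -
      MvPolynomial.monomial (Finsupp.equivFunOnFinite.symm fun j => (-l j).toNat) 1) := by
    rw [mul_sub, MvPolynomial.monomial_mul, MvPolynomial.monomial_mul, one_mul]
    congr 3 <;> ext j <;> simp [l] <;> omega
  rw [e, map_mul, ← box_eq]
  exact Submodule.smul_mem _ _ (Submodule.subset_span ⟨l, hl, rfl⟩)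

/-- The annihilator of `1 ∈ R'` in the Weyl algebra is `∑_{l ∈ L} 𝒟 □_l`. -/
theorem mem_boxIdeal_of_weylAction_one (P : Weyl N) (hP : weylAction a P 1 = 0) :
    P ∈ boxIdeal a := by
  obtain ⟨h, rfl⟩ := Weyl.normal_surjective P
  rw [weylAction_normal_one, map_eq_zero_iff _ coeffs.symm.injective] at hP
  -- One exponent is chosen in each fibre of the weight map. Moving all coefficients to the chosen
  -- exponents changes an operator only by box operators, and the result is zero when P · 1 = 0.
  let s : (Fin n → ℤ) → (Fin N →₀ ℕ) := Function.invFun (weight a)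
  have hs : ∀ q, weight a (s (weight a q)) = weight a q := fun q =>
    Function.invFun_eq ⟨q, rfl⟩
  have key : ∀ h : (Fin N →₀ ℕ) →₀ Params N,
      Weyl.normal h - Weyl.normal ((h.mapDomain (weight a)).mapDomain s) ∈ boxIdeal a := by
    intro h
    induction h using Finsupp.induction_linear with
    | zero => simp
    | add f g hf hg =>
      simp only [Finsupp.mapDomain_add, map_add, add_sub_add_comm]
      exact add_mem hf hg
    | single q f =>
      rw [Finsupp.mapDomain_single, Finsupp.mapDomain_single, Weyl.normal_single,
        Weyl.normal_single, ← mul_sub, ← map_sub]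
      exact Submodule.smul_mem _ _ (ofPartial_sub_mem_boxIdeal a _ _ (hs q).symm)
  simpa [hP] using key h

theorem weylAction_boxIdeal_one (P : Weyl N) (hP : P ∈ boxIdeal a) : weylAction a P 1 = 0 := by
  refine Submodule.span_induction ?_ ?_ ?_ ?_ hP
  · rintro _ ⟨l, hl, rfl⟩
    rw [box_eq, map_sub, map_sub, LinearMap.sub_apply, ← mono_zero, weylAction_ofPartial_monomial,
      weylAction_ofPartial_monomial, sub_eq_zero]
    congr 2
    rw [weight_eq_sum, weight_eq_sum, ← sub_eq_zero, ← Finset.sum_sub_distrib]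
    refine Eq.trans (Finset.sum_congr rfl fun j _ => ?_) hl
    simp only [Finsupp.coe_equivFunOnFinite_symm, ← natCast_zsmul, ← sub_smul]
    congr 1
    omega
  · simp
  · intro x y _ _ hx hy
    rw [map_add, LinearMap.add_apply, hx, hy, add_zero]
  · intro Q x _ hx
    rw [smul_eq_mul, map_mul, Module.End.mul_apply, hx, map_zero]

/-! ### The operators D_{i,α} on monomials and the Euler operators on 1 -/

variable (α : Fin n → ℂ)

theorem twistedTheta_mono (i : Fin n) (u : Fin n → ℤ) :
    twistedTheta a α i (mono u) =
      (MvPolynomial.C (α i + u i) : Params N) • mono u +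
        ∑ j, ((a j i : Params N) * MvPolynomial.X j) • mono (u + a j) := by
  have h1 := theta_term (N := N) i 1 u
  rw [one_smul, one_mul] at h1
  have h2 : algebraMap ℂ (Torus n N) (α i) * mono u =
      (MvPolynomial.C (α i) : Params N) • mono u := by
    rw [IsScalarTower.algebraMap_apply ℂ (Params N) (Torus n N), ← Algebra.smul_def,
      MvPolynomial.algebraMap_eq]
  have h3 : theta i (genericPoly a : Torus n N) * mono u =
      ∑ j, ((a j i : Params N) * MvPolynomial.X j) • mono (u + a j) := by
    rw [genericPoly, map_sum, Finset.sum_mul]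
    refine Finset.sum_congr rfl fun j _ => ?_
    rw [theta_term, smul_mul_assoc, mono_mul, mul_comm, add_comm u]
  rw [twistedTheta_apply, add_mul, h1, h2, h3, ← add_assoc, ← add_smul, map_add, add_comm,
    add_comm (u i : Params N), map_intCast, add_comm]

/-- This fixes the sign in the theorem: the parameter -α of the Euler operator becomes the summand
+α_i of D_{i,α}. The equality is at the vector 1 only; it extends to 𝒟 · 1 through commutation. -/
theorem weylAction_eulerOp_one (i : Fin n) :
    weylAction a (eulerOp a (-α) i) 1 = twistedTheta a α i 1 := by
  rw [← mono_zero, twistedTheta_mono, eulerOp, map_sub, map_sum, LinearMap.sub_apply,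
    AlgHom.commutes, Module.algebraMap_end_apply, LinearMap.sum_apply]
  have h : ∀ j, weylAction a ((a j i : Weyl N) * (Weyl.coord j * Weyl.partial j))
      (mono 0 : Torus n N) = ((a j i : Params N) * MvPolynomial.X j) • mono (0 + a j) := by
    intro j
    have : (a j i : Weyl N) * (Weyl.coord j * Weyl.partial j) =
        Weyl.ofCoord ((a j i : Params N) * MvPolynomial.X j) * Weyl.partial j := by
      rw [map_mul, map_intCast, Weyl.ofCoord_X, mul_assoc]
    rw [this, map_mul, Module.End.mul_apply, weylAction_partial_mono, weylAction_ofCoord]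
  simp only [h, Pi.neg_apply, neg_smul, sub_neg_eq_add, Pi.zero_apply, Int.cast_zero, add_zero]
  rw [add_comm, ← MvPolynomial.algebraMap_eq, algebraMap_smul]

end

section

/-! ### Facets of the cone -/

section Farkas

variable {F W ι : Type*} [Field F] [LinearOrder F] [IsStrictOrderedRing F] [AddCommGroup W]
  [Module F W]

/-- Farkas' lemma for linear forms over an ordered field. -/
theorem exists_nonneg_combination (s : Finset ι) (f : ι → Module.Dual F W) (g : Module.Dual F W)
    (h : ∀ w, (∀ k ∈ s, 0 ≤ f k w) → 0 ≤ g w) :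
    ∃ c : ι → F, (∀ k, 0 ≤ c k) ∧ g = ∑ k ∈ s, c k • f k := by
  classical
  induction s using Finset.induction_on generalizing f g with
  | empty =>
    refine ⟨0, fun _ => le_rfl, ?_⟩
    ext w
    have h1 := h w (by simp)
    have h2 := h (-w) (by simp)
    rw [map_neg] at h2
    simp only [Finset.sum_empty, LinearMap.zero_apply]
    linarith
  | insert i s hi ih =>
    by_cases hg : ∀ w, (∀ k ∈ s, 0 ≤ f k w) → 0 ≤ g w
    · obtain ⟨c, hc, e⟩ := ih f g hg
      refine ⟨Function.update c i 0, fun k => ?_, ?_⟩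
      · by_cases hk : k = i
        · subst hk; simp
        · simp [hk, hc]
      · rw [Finset.sum_insert hi, Function.update_self, zero_smul, zero_add, e]
        refine Finset.sum_congr rfl fun k hk => ?_
        rw [Function.update_of_ne (ne_of_mem_of_not_mem hk hi)]
    -- Otherwise f_i is needed: some w₁ has g < 0 although all f_k, k ∈ s, are nonnegative there. It
    -- is rescaled to w₀ with f_i(w₀) = -1.
    · push Not at hg
      obtain ⟨w₁, hw₁, hgw₁⟩ := hg
      have hfi : f i w₁ < 0 := by
        by_contra hc
        rw [not_lt] at hc
        exact absurd (h w₁ fun k hk => by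
          rcases Finset.mem_insert.1 hk with rfl | hk
          exacts [hc, hw₁ k hk]) (not_le.2 hgw₁)
      obtain ⟨w₀, hw₀, hgw₀, hfw₀⟩ : ∃ w₀, (∀ k ∈ s, 0 ≤ f k w₀) ∧ g w₀ < 0 ∧ f i w₀ = -1 := by
        refine ⟨(-(f i w₁)⁻¹) • w₁, fun k hk => ?_, ?_, ?_⟩
        · rw [map_smul, smul_eq_mul]
          exact mul_nonneg (neg_nonneg.2 (inv_nonpos.2 hfi.le)) (hw₁ k hk)
        · rw [map_smul, smul_eq_mul]
          exact mul_neg_of_pos_of_neg (neg_pos.2 (inv_lt_zero.2 hfi)) hgw₁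
        · rw [map_smul, smul_eq_mul, neg_mul, inv_mul_cancel₀ hfi.ne]
      -- These are the forms f_k and g composed with the projection w ↦ w + f_i(w) w₀ onto the
      -- kernel of f_i, where the constraint from f_i holds automatically. The coefficient of f_i in
      -- the resulting expression for g is ∑ c_k f_k(w₀) - g(w₀), which is nonnegative by the choice
      -- of w₀.
      obtain ⟨c, hc, e⟩ := ih (fun k => f k + f k w₀ • f i) (g + g w₀ • f i) fun w hw => by
        have hz : f i (w + f i w • w₀) = 0 := by
          rw [map_add, map_smul, hfw₀, smul_eq_mul, mul_neg, mul_one, add_neg_cancel]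
        have := h (w + f i w • w₀) fun k hk => by
          rcases Finset.mem_insert.1 hk with rfl | hk
          · rw [hz]
          · have := hw k hk
            simpa [mul_comm] using this
        simpa [mul_comm] using this
      refine ⟨Function.update c i (∑ k ∈ s, c k * f k w₀ - g w₀), fun k => ?_, ?_⟩
      · by_cases hk : k = i
        · subst hk
          rw [Function.update_self]
          have := Finset.sum_nonneg fun k hk => mul_nonneg (hc k) (hw₀ k hk)
          linarith
        · simp [hk, hc]
      · rw [Finset.sum_insert hi, Function.update_self]
        have e' : ∑ k ∈ s, Function.update c i (∑ k ∈ s, c k * f k w₀ - g w₀) k • f k =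
            ∑ k ∈ s, c k • f k := by
          refine Finset.sum_congr rfl fun k hk => ?_
          rw [Function.update_of_ne (ne_of_mem_of_not_mem hk hi)]
        rw [e']
        simp only [smul_add, Finset.sum_add_distrib, smul_smul, ← Finset.sum_smul] at e
        ext w
        have := LinearMap.congr_fun e w
        simp only [LinearMap.add_apply, LinearMap.smul_apply, smul_eq_mul] at this ⊢
        linear_combination this

end Farkas

/-- Rational vectors have a common denominator. -/
theorem exists_common_denominator {ι : Type*} [Fintype ι] (v : ι → ℚ) :
    ∃ (d : ℕ) (w : ι → ℤ), 0 < d ∧ ∀ i, (w i : ℚ) = d * v i := by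
  classical
  refine ⟨∏ i, (v i).den, fun i => (∏ k ∈ Finset.univ.erase i, ((v k).den : ℤ)) * (v i).num,
    Finset.prod_pos fun i _ => (v i).den_pos, fun i => ?_⟩
  rw [← Finset.mul_prod_erase _ _ (Finset.mem_univ i)]
  push_cast
  rw [mul_right_comm, Rat.den_mul_eq_num, mul_comm]

/-- A nonzero rational vector has a primitive integral multiple. -/
theorem exists_primitive_multiple (v : Fin n → ℚ) (hv : v ≠ 0) :
    ∃ (c : Fin n → ℤ) (t : ℚ), 0 < t ∧ Finset.univ.gcd c = 1 ∧ ∀ i, (c i : ℚ) = t * v i := by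
  obtain ⟨d, w, hd, hw⟩ := exists_common_denominator v
  have hdQ : (0 : ℚ) < d := by exact_mod_cast hd
  obtain ⟨i, hi⟩ : ∃ i, v i ≠ 0 := Function.ne_iff.1 hv
  have hwi : w i ≠ 0 := by
    have : (w i : ℚ) ≠ 0 := by rw [hw]; exact mul_ne_zero hdQ.ne' hi
    exact_mod_cast this
  obtain ⟨c, hc, hgcd⟩ := Finset.extract_gcd w ⟨i, Finset.mem_univ i⟩
  have hg : (Finset.univ.gcd w) ≠ 0 := fun h0 =>
    hwi (Finset.gcd_eq_zero_iff.1 h0 i (Finset.mem_univ i))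
  have hg' : 0 < Finset.univ.gcd w :=
     lt_of_le_of_ne (Int.nonneg_of_normalize_eq_self Finset.normalize_gcd) hg.symm
  have hgQ : (0 : ℚ) < (Finset.univ.gcd w : ℤ) := by exact_mod_cast hg'
  refine ⟨c, d / (Finset.univ.gcd w : ℤ), div_pos hdQ hgQ, hgcd, fun k => ?_⟩
  have := hw k
  rw [hc k (Finset.mem_univ k), Int.cast_mul] at this
  field_simp
  linarith

/-! ### Supporting forms of the cone with rational coefficients -/

variable (a : Fin N → Fin n → ℤ)

/-- The value of a rational linear form at `a^{(j)}`, as a linear form in its coefficients. -/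
def pairing (k : Fin N) : Module.Dual ℚ (Fin n → ℚ) :=
  ∑ i, (a k i : ℚ) • LinearMap.proj i

theorem pairing_apply (k : Fin N) (l : Fin n → ℚ) : pairing a k l = ∑ i, (a k i : ℚ) * l i := by
  simp [pairing]

theorem pairing_single (k : Fin N) (i : Fin n) : pairing a k (Pi.single i 1) = a k i := by
  simp [pairing_apply, Pi.single_apply]

/-- If 0 is the only form that is nonnegative at all a^{(k)} and zero on J, then Farkas' lemma
writes each -a^{(k)} as a nonnegative combination of the a^{(m)} and the -a^{(j)}, j ∈ J. Adding
these up over k and clearing denominators gives a combination of the kind that the hypothesis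
excludes. -/
theorem exists_supporting_form (J : Finset (Fin N))
    (hJ : ∀ c p : Fin N → ℕ, (∀ k, 0 < c k) → ∑ k, c k • a k ≠ ∑ j ∈ J, p j • a j) :
    ∃ l : Fin n → ℚ, l ≠ 0 ∧ (∀ k, 0 ≤ pairing a k l) ∧ ∀ j ∈ J, pairing a j l = 0 := by
  classical
  by_contra hcon
  let s : Finset (Fin N ⊕ Fin N) := Finset.univ.disjSum J
  let f : Fin N ⊕ Fin N → Module.Dual ℚ (Fin n → ℚ) := Sum.elim (pairing a) fun j => -pairing a j
  have hk : ∀ k, ∃ c : Fin N ⊕ Fin N → ℚ, (∀ x, 0 ≤ c x) ∧ -pairing a k = ∑ x ∈ s, c x • f x := by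
    intro k
    refine exists_nonneg_combination s f _ fun w hw => ?_
    by_contra hneg
    rw [LinearMap.neg_apply, not_le, neg_lt_zero] at hneg
    have h1 : ∀ k, 0 ≤ pairing a k w := fun k =>
      hw (Sum.inl k) (Finset.inl_mem_disjSum.2 (Finset.mem_univ k))
    refine hcon ⟨w, ?_, h1, fun j hj => le_antisymm ?_ (h1 j)⟩
    · rintro rfl; simp at hneg
    · have := hw (Sum.inr j) (Finset.inr_mem_disjSum.2 hj)
      simpa [f] using this
  choose c hc e using hk
  -- The summand 1 comes from moving ∑_k -a^{(k)} to the other side. It makes every coefficient on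
  -- the left strictly positive.
  obtain ⟨d, w, hd, hw⟩ := exists_common_denominator
    (Sum.elim (fun k => 1 + ∑ m, c m (Sum.inl k)) fun j => ∑ m, c m (Sum.inr j))
  have hdQ : (0 : ℚ) < d := by exact_mod_cast hd
  have hsum : ∑ k, (1 + ∑ m, c m (Sum.inl k)) • pairing a k =
      ∑ j ∈ J, (∑ m, c m (Sum.inr j)) • pairing a j := by
    have h2 : ∑ k, -pairing a k = ∑ k, ∑ x ∈ s, c k x • f x := Finset.sum_congr rfl fun k _ => e k
    simp only [s, Finset.sum_disjSum, f, Sum.elim_inl, Sum.elim_inr, smul_neg,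
      Finset.sum_neg_distrib, Finset.sum_add_distrib] at h2
    rw [Finset.sum_comm, Finset.sum_comm (s := Finset.univ) (t := J)] at h2
    simp only [← Finset.sum_smul] at h2
    simp only [add_smul, one_smul, Finset.sum_add_distrib]
    rw [← sub_eq_zero] at h2 ⊢
    rw [← neg_eq_zero, ← h2]
    abel
  have hnn : ∀ x, 0 ≤ w x := by
    intro x
    have : (0 : ℚ) ≤ w x := by
      rw [hw]
      refine mul_nonneg hdQ.le ?_
      cases x with
      | inl k => exact add_nonneg zero_le_one (Finset.sum_nonneg fun m _ => hc m _)
      | inr j => exact Finset.sum_nonneg fun m _ => hc m _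
    exact_mod_cast this
  refine hJ (fun k => (w (Sum.inl k)).toNat) (fun j => (w (Sum.inr j)).toNat) (fun k => ?_) ?_
  · have : (0 : ℚ) < w (Sum.inl k) := by
      rw [hw]
      exact mul_pos hdQ (add_pos_of_pos_of_nonneg zero_lt_one
        (Finset.sum_nonneg fun m _ => hc m _))
    have h3 : 0 < w (Sum.inl k) := by exact_mod_cast this
    omega
  · ext i
    have h4 := congrArg (fun φ => (d : ℚ) * φ (Pi.single i 1)) hsum
    simp only [LinearMap.sum_apply, LinearMap.smul_apply, pairing_single, smul_eq_mul,
      Finset.mul_sum, ← mul_assoc] at h4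
    have h5 : ∀ k, (d : ℚ) * (1 + ∑ m, c m (Sum.inl k)) = w (Sum.inl k) := fun k =>
      (hw (Sum.inl k)).symm
    have h6 : ∀ j, (d : ℚ) * (∑ m, c m (Sum.inr j)) = w (Sum.inr j) := fun j =>
      (hw (Sum.inr j)).symm
    simp only [← Finset.mul_sum, h5, h6] at h4
    simp only [Finset.sum_apply, Pi.smul_apply, ← natCast_zsmul, Int.toNat_of_nonneg (hnn _),
      smul_eq_mul]
    exact_mod_cast h4

theorem eq_zero_of_pairing_eq_zero (ha : AddSubgroup.closure (Set.range a) = ⊤) (l : Fin n → ℚ)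
    (h : ∀ k, pairing a k l = 0) : l = 0 := by
  ext i
  have : ∀ u ∈ AddSubgroup.closure (Set.range a), ∑ i, (u i : ℚ) * l i = 0 := by
    intro u hu
    induction hu using AddSubgroup.closure_induction with
    | mem x hx => obtain ⟨k, rfl⟩ := hx; rw [← pairing_apply]; exact h k
    | zero => simp
    | add x y _ _ hx hy => simp [add_mul, Finset.sum_add_distrib, hx, hy]
    | neg x _ hx => simp [hx]
  have := this (Pi.single i 1) (by rw [ha]; trivial)
  simpa [Pi.single_apply] using this

/-- A supporting form can be replaced by one which is determined by its zeros. -/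
theorem exists_extremal_form (ha : AddSubgroup.closure (Set.range a) = ⊤) (J : Finset (Fin N))
    (hex : ∃ l : Fin n → ℚ, l ≠ 0 ∧ (∀ k, 0 ≤ pairing a k l) ∧ ∀ j ∈ J, pairing a j l = 0) :
    ∃ l : Fin n → ℚ, l ≠ 0 ∧ (∀ k, 0 ≤ pairing a k l) ∧ (∀ j ∈ J, pairing a j l = 0) ∧
      ∀ m : Fin n → ℚ, (∀ k, pairing a k l = 0 → pairing a k m = 0) → ∃ t : ℚ, m = t • l := by
  classical
  let Z : (Fin n → ℚ) → Finset (Fin N) := fun l => Finset.univ.filter fun k => pairing a k l = 0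
  let X : Set (Fin n → ℚ) :=
    {l | l ≠ 0 ∧ (∀ k, 0 ≤ pairing a k l) ∧ ∀ j ∈ J, pairing a j l = 0}
  -- Among the supporting forms vanishing on J, l has the largest number of zeros among the a^{(k)}.
  obtain ⟨l, hl, hmin⟩ := (InvImage.wf (fun l : Fin n → ℚ => (Z l)ᶜ.card)
    (wellFounded_lt (α := ℕ))).has_min X hex
  refine ⟨l, hl.1, hl.2.1, hl.2.2, fun m hm => ?_⟩
  by_contra hcon
  push Not at hcon
  have hne : ((Z l)ᶜ).Nonempty := by
    by_contra hemp
    rw [Finset.not_nonempty_iff_eq_empty] at hemp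
    refine hl.1 (eq_zero_of_pairing_eq_zero a ha l fun k => ?_)
    have : k ∈ Z l := by
      by_contra hk
      rw [← Finset.mem_compl, hemp] at hk
      simp at hk
    exact (Finset.mem_filter.1 this).2
  -- With r the smallest ratio m/l over the points where l is positive, m - r l is still
  -- nonnegative, keeps the zeros of l and gains the zero k₀. It is nonzero if m is not a multiple
  -- of l, which contradicts the choice of l.
  obtain ⟨k₀, hk₀, hmin₀⟩ := Finset.exists_min_image (Z l)ᶜ
    (fun k => pairing a k m / pairing a k l) hne
  have hpos : ∀ k ∈ (Z l)ᶜ, 0 < pairing a k l := fun k hk => by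
    refine lt_of_le_of_ne (hl.2.1 k) fun h0 => ?_
    rw [Finset.mem_compl] at hk
    exact hk (Finset.mem_filter.2 ⟨Finset.mem_univ k, h0.symm⟩)
  let r := pairing a k₀ m / pairing a k₀ l
  have hzero : ∀ k, pairing a k l = 0 → pairing a k (m - r • l) = 0 := fun k hk => by
    rw [map_sub, map_smul, hm k hk, hk, smul_zero, sub_zero]
  refine hmin (m - r • l) ⟨sub_ne_zero.2 (hcon r), fun k => ?_, fun j hj =>
    hzero j (hl.2.2 j hj)⟩ ?_
  · by_cases hk : k ∈ Z l
    · exact (hzero k (Finset.mem_filter.1 hk).2).ge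
    · rw [← Finset.mem_compl] at hk
      have := hmin₀ k hk
      rw [le_div_iff₀ (hpos k hk)] at this
      rw [map_sub, map_smul, smul_eq_mul]
      exact sub_nonneg.2 this
  · refine Finset.card_lt_card ⟨fun k hk => ?_, fun hsub => ?_⟩
    · rw [Finset.mem_compl] at hk ⊢
      exact fun h => hk (Finset.mem_filter.2 ⟨Finset.mem_univ k,
        hzero k (Finset.mem_filter.1 h).2⟩)
    · have := hsub hk₀
      rw [Finset.mem_compl] at this
      refine this (Finset.mem_filter.2 ⟨Finset.mem_univ _, ?_⟩)
      rw [map_sub, map_smul, smul_eq_mul, div_mul_cancel₀ _ (hpos k₀ hk₀).ne', sub_self]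

/-- A rational form which is determined up to scaling by its zeros among the `a^{(k)}` has
`n - 1` linearly independent zeros among them. -/
theorem finrank_span_zeros (l : Fin n → ℚ) (hl : l ≠ 0)
    (hm : ∀ m : Fin n → ℚ, (∀ k, pairing a k l = 0 → pairing a k m = 0) → ∃ t : ℚ, m = t • l) :
    Module.finrank ℚ (Submodule.span ℚ
      ((fun k i => (a k i : ℚ)) '' {k | pairing a k l = 0})) + 1 = n := by
  let U := Submodule.span ℚ ((fun k i => (a k i : ℚ)) '' {k | pairing a k l = 0})
  have h1 := Subspace.finrank_add_finrank_dualAnnihilator_eq U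
  rw [Module.finrank_fin_fun] at h1
  have heq : ∀ φ : Module.Dual ℚ (Fin n → ℚ), ∀ k,
      φ (fun i => (a k i : ℚ)) = pairing a k fun i => φ (Pi.single i 1) := by
    intro φ k
    rw [pairing_apply, LinearMap.pi_apply_eq_sum_univ φ]
    refine Finset.sum_congr rfl fun i _ => ?_
    rw [smul_eq_mul]
    congr 2
    ext j
    simp [Pi.single_apply, eq_comm]
  let φ₀ : Module.Dual ℚ (Fin n → ℚ) := ∑ i, l i • LinearMap.proj i
  have hφ₀ : ∀ i, φ₀ (Pi.single i 1) = l i := fun i => by simp [φ₀, Pi.single_apply]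
  have hφ₀' : φ₀ ≠ 0 := by
    rintro h0
    refine hl (funext fun i => ?_)
    rw [← hφ₀, h0]; rfl
  -- That l is determined up to scaling by its zeros says that their span has a one-dimensional
  -- annihilator.
  have h2 : U.dualAnnihilator = Submodule.span ℚ {φ₀} := by
    apply le_antisymm
    · intro φ hφ
      rw [Submodule.mem_dualAnnihilator] at hφ
      obtain ⟨t, ht⟩ := hm (fun i => φ (Pi.single i 1)) fun k hk => by
        rw [← heq]
        exact hφ _ (Submodule.subset_span ⟨k, hk, rfl⟩)
      rw [Submodule.mem_span_singleton]
      refine ⟨t, ?_⟩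
      refine LinearMap.pi_ext' fun i => LinearMap.ext_ring ?_
      have := congrFun ht i
      simpa [hφ₀] using this.symm
    · rw [Submodule.span_singleton_le_iff_mem, Submodule.mem_dualAnnihilator]
      intro w hw
      refine Submodule.span_induction ?_ (map_zero _) (fun x y _ _ hx hy => ?_)
        (fun t x _ hx => ?_) hw
      · rintro _ ⟨k, hk, rfl⟩
        rw [heq]
        simp only [hφ₀]
        exact hk
      · rw [map_add, hx, hy, add_zero]
      · rw [map_smul, hx, smul_zero]
  rw [h2, finrank_span_singleton hφ₀'] at h1
  exact h1

/-- If no positive combination of all the `a^{(k)}` is a combination of the `a^{(j)}`, `j ∈ J`,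
then some facet form vanishes at the `a^{(j)}`, `j ∈ J`. -/
theorem exists_isFacetForm (ha : AddSubgroup.closure (Set.range a) = ⊤) (J : Finset (Fin N))
    (hJ : ∀ c p : Fin N → ℕ, (∀ k, 0 < c k) → ∑ k, c k • a k ≠ ∑ j ∈ J, p j • a j) :
    ∃ c : Fin n → ℤ, IsFacetForm a c ∧ ∀ j ∈ J, ∑ i, c i * a j i = 0 := by
  obtain ⟨l, hl, hnn, hlJ, hm⟩ := exists_extremal_form a ha J (exists_supporting_form a J hJ)
  obtain ⟨c, t, ht, hgcd, hc⟩ := exists_primitive_multiple l hl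
  have hpair : ∀ k, ((∑ i, c i * a k i : ℤ) : ℚ) = t * pairing a k l := fun k => by
    push_cast
    rw [pairing_apply, Finset.mul_sum]
    exact Finset.sum_congr rfl fun i _ => by rw [hc]; ring
  have hzero : ∀ k, pairing a k l = 0 → ∑ i, c i * a k i = 0 := fun k hk => by
    have := hpair k
    rw [hk, mul_zero] at this
    exact_mod_cast this
  refine ⟨c, ⟨hgcd, fun u hu => ?_, ?_⟩, fun j hj => hzero j (hlJ j hj)⟩
  · refine Submodule.span_induction ?_ (by simp) (fun x y _ _ hx hy => ?_) (fun r x _ hx => ?_) hu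
    · rintro _ ⟨k, rfl⟩
      have h0 : (0 : ℚ) ≤ (∑ i, c i * a k i : ℤ) := by
        rw [hpair]
        exact mul_nonneg ht.le (hnn k)
      have h1 : (0 : ℤ) ≤ ∑ i, c i * a k i := by exact_mod_cast h0
      change (0 : ℝ) ≤ ∑ i, (c i : ℝ) * (a k i : ℝ)
      exact_mod_cast h1
    · simp only [Pi.add_apply, mul_add, Finset.sum_add_distrib]
      exact add_nonneg hx hy
    · have : ∑ i, (c i : ℝ) * (r • x) i = (r : ℝ) * ∑ i, (c i : ℝ) * x i := by
        rw [Finset.mul_sum]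
        exact Finset.sum_congr rfl fun i _ => mul_left_comm _ _ _
      rw [this]
      exact mul_nonneg r.2 hx
  · set U := Submodule.span ℝ {u : Fin n → ℝ | u ∈ cone a ∧ ∑ i, (c i : ℝ) * u i = 0}
    have hrank := finrank_span_zeros a l hl hm
    apply le_antisymm
    -- Upper bound: the face lies in the kernel of a nonzero form.
    · let φ : Module.Dual ℝ (Fin n → ℝ) := ∑ i, (c i : ℝ) • LinearMap.proj i
      have hφ : ∀ u, φ u = ∑ i, (c i : ℝ) * u i := fun u => by simp [φ]
      have hlt : U < ⊤ := by
        refine lt_of_le_of_lt (b := LinearMap.ker φ) (Submodule.span_le.2 fun u hu => ?_) ?_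
        · rw [SetLike.mem_coe, LinearMap.mem_ker, hφ]
          exact hu.2
        · rw [lt_top_iff_ne_top, Ne, LinearMap.ker_eq_top]
          intro h0
          obtain ⟨i, hi⟩ := Function.ne_iff.1 hl
          have h1 : φ (Pi.single i 1) = c i := by simp [hφ, Pi.single_apply]
          rw [h0, LinearMap.zero_apply] at h1
          have h2 : c i = 0 := by exact_mod_cast h1.symm
          have h3 := hc i
          rw [h2, Int.cast_zero, eq_comm] at h3
          exact hi ((mul_eq_zero.1 h3).resolve_left ht.ne')
      have := Submodule.finrank_lt hlt.ne
      rw [Module.finrank_fin_fun] at this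
      omega
    -- Lower bound: among the a^{(k)} on the face there are n - 1 that are independent over ℚ, and
    -- rational vectors independent over ℚ stay independent over ℝ.
    · obtain ⟨b, hb, hspan, hli⟩ := exists_linearIndependent ℚ
        ((fun k i => (a k i : ℚ)) '' {k | pairing a k l = 0})
      have hfin : Fintype b := (((Set.toFinite _).image _).subset hb).fintype
      have hcard := finrank_span_eq_card hli
      rw [Subtype.range_coe, hspan] at hcard
      have hliR : LinearIndependent ℝ (fun x : b => fun i => ((x.1 i : ℚ) : ℝ)) := by
        have := (linearIndependent_algebraMap_comp_iff (R := ℚ) (S := ℝ)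
          (v := fun x : b => x.1)).2 hli
        exact this
      have hmem : ∀ x : b, (fun i => ((x.1 i : ℚ) : ℝ)) ∈ U := by
        intro x
        obtain ⟨k, hk, hx⟩ := hb x.2
        refine Submodule.subset_span ⟨?_, ?_⟩
        · have : (fun i => ((x.1 i : ℚ) : ℝ)) = fun i => (a k i : ℝ) := by
            ext i; rw [← hx]; simp
          rw [this]
          exact Submodule.subset_span ⟨k, rfl⟩
        · rw [← hx]
          have := hzero k hk
          simp only [Rat.cast_intCast]
          exact_mod_cast this
      have hliU : LinearIndependent ℝ fun x : b => (⟨_, hmem x⟩ : U) :=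
        LinearIndependent.of_comp U.subtype hliR
      have := hliU.fintype_card_le_finrank
      rw [Fintype.card_eq_nat_card] at this hcard
      rw [hcard] at hrank
      exact hrank.ge.trans (Nat.succ_le_succ this)

end

section

/-! ### Comparison of `R'` with its submodule generated by `1` -/

variable (a : Fin N → Fin n → ℤ) (α : Fin n → ℂ)

/-- The operators that are products of operators `1 - ∑_i c_i D_{i,α}`. -/
def unipotents : Submonoid (Module.End ℂ (Torus n N)) :=
  Submonoid.closure (Set.range fun c : Fin n → ℂ => 1 - ∑ i, c i • twistedTheta a α i)

variable {a α}

theorem commute_of_mem_unipotents {T S : Module.End ℂ (Torus n N)} (hT : T ∈ unipotents a α)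
    (hS : ∀ i, Commute (twistedTheta a α i) S) : Commute T S := by
  induction hT using Submonoid.closure_induction with
  | mem x hx =>
    obtain ⟨c, rfl⟩ := hx
    exact (Commute.one_left S).sub_left
      (Commute.sum_left _ _ _ fun i _ => (hS i).smul_left (c i))
  | one => exact Commute.one_left S
  | mul x y _ _ hx hy => exact hx.mul_left hy

theorem unipotents_comm {T S : Module.End ℂ (Torus n N)} (hT : T ∈ unipotents a α)
    (hS : S ∈ unipotents a α) : Commute T S :=
  commute_of_mem_unipotents hT fun i =>
    (commute_of_mem_unipotents hS fun j => twistedTheta_comm a α j i).symm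

/-- Each factor differs from 1 by a combination of the D_{i,α}. The subspace U is arbitrary so that
the congruence can be used in R' and, with witnesses s_i kept inside it, in 𝒟 · 1. -/
theorem unipotents_sub_mem {T : Module.End ℂ (Torus n N)} (hT : T ∈ unipotents a α)
    (U : Submodule ℂ (Torus n N)) (hU : ∀ i, ∀ r ∈ U, twistedTheta a α i r ∈ U)
    (r : Torus n N) (hr : r ∈ U) :
    T r ∈ U ∧ ∃ s : Fin n → Torus n N, (∀ i, s i ∈ U) ∧
      r - T r = ∑ i, twistedTheta a α i (s i) := by
  induction hT using Submonoid.closure_induction generalizing r with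
  | mem x hx =>
    obtain ⟨c, rfl⟩ := hx
    have h : r - (1 - ∑ i, c i • twistedTheta a α i) r = ∑ i, twistedTheta a α i (c i • r) := by
      simp [LinearMap.sum_apply]
    refine ⟨?_, fun i => c i • r, fun i => U.smul_mem _ hr, h⟩
    rw [eq_sub_of_add_eq' (sub_eq_iff_eq_add.1 h).symm]
    exact U.sub_mem hr (U.sum_mem fun i _ => hU i _ (U.smul_mem _ hr))
  | one => exact ⟨hr, 0, fun _ => U.zero_mem, by simp⟩
  | mul x y _ _ hx hy =>
    obtain ⟨hyr, s, hs, es⟩ := hy r hr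
    obtain ⟨hxr, t, ht, et⟩ := hx _ hyr
    refine ⟨hxr, s + t, fun i => U.add_mem (hs i) (ht i), ?_⟩
    simp only [Pi.add_apply, map_add, Finset.sum_add_distrib, ← es, ← et, Module.End.mul_apply]
    abel

variable (a α)

/-- The submodule `𝒟 · 1` of `R'`. -/
def cyclicPart : Submodule ℂ (Torus n N) :=
  LinearMap.range ((LinearMap.applyₗ (1 : Torus n N)).comp (weylAction a).toLinearMap)

variable {a} in
theorem mem_cyclicPart {r : Torus n N} : r ∈ cyclicPart a ↔ ∃ P, weylAction a P 1 = r := Iff.rfl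

theorem weylAction_mem_cyclicPart (P : Weyl N) (r : Torus n N) (hr : r ∈ cyclicPart a) :
    weylAction a P r ∈ cyclicPart a := by
  obtain ⟨Q, rfl⟩ := mem_cyclicPart.1 hr
  exact ⟨P * Q, by simp⟩

/-- By commutation D_{i,α}(P · 1) = P · (D_{i,α} 1). Thus the D_{i,α} on 𝒟 · 1 correspond to right
multiplication by the Euler operators on 𝒟. -/
theorem twistedTheta_weylAction_one (i : Fin n) (P : Weyl N) :
    twistedTheta a α i (weylAction a P 1) = weylAction a (P * eulerOp a (-α) i) 1 := by
  rw [map_mul, Module.End.mul_apply, weylAction_eulerOp_one, ← Module.End.mul_apply,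
    (twistedTheta_weylAction a α i P).eq, Module.End.mul_apply]

theorem twistedTheta_mem_cyclicPart (i : Fin n) (r : Torus n N) (hr : r ∈ cyclicPart a) :
    twistedTheta a α i r ∈ cyclicPart a := by
  obtain ⟨P, rfl⟩ := mem_cyclicPart.1 hr
  exact ⟨_, (twistedTheta_weylAction_one a α i P).symm⟩

/-- The elements of `R'` that are mapped to `𝒟 · 1` by a product of operators
`1 - ∑_i c_i D_{i,α}`. -/
def absorbed : Submodule ℂ (Torus n N) where
  carrier := {r | ∃ T ∈ unipotents a α, T r ∈ cyclicPart a}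
  zero_mem' := ⟨1, one_mem _, by simp⟩
  add_mem' := by
    rintro r s ⟨T, hT, hr⟩ ⟨S, hS, hs⟩
    refine ⟨T * S, mul_mem hT hS, ?_⟩
    rw [map_add]
    refine add_mem ?_ ?_
    · rw [(unipotents_comm hT hS).eq]
      exact (unipotents_sub_mem hS _ (twistedTheta_mem_cyclicPart a α) _ hr).1
    · exact (unipotents_sub_mem hT _ (twistedTheta_mem_cyclicPart a α) _ hs).1
  smul_mem' := by
    rintro z r ⟨T, hT, hr⟩
    exact ⟨T, hT, by rw [map_smul]; exact Submodule.smul_mem _ z hr⟩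

variable {a α} in
theorem mem_absorbed {r : Torus n N} :
    r ∈ absorbed a α ↔ ∃ T ∈ unipotents a α, T r ∈ cyclicPart a := Iff.rfl

theorem weylAction_mem_absorbed (P : Weyl N) (r : Torus n N) (hr : r ∈ absorbed a α) :
    weylAction a P r ∈ absorbed a α := by
  obtain ⟨T, hT, hr⟩ := mem_absorbed.1 hr
  refine ⟨T, hT, ?_⟩
  rw [← Module.End.mul_apply,
    (commute_of_mem_unipotents hT fun i => twistedTheta_weylAction a α i P).eq]
  exact weylAction_mem_cyclicPart a P _ hr

theorem mem_absorbed_of_unipotent {T : Module.End ℂ (Torus n N)} (hT : T ∈ unipotents a α)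
    (r : Torus n N) (hr : T r ∈ absorbed a α) : r ∈ absorbed a α := by
  obtain ⟨S, hS, hr⟩ := mem_absorbed.1 hr
  exact ⟨S * T, mul_mem hS hT, hr⟩

theorem smul_mem_absorbed (f : Params N) (r : Torus n N) (hr : r ∈ absorbed a α) :
    f • r ∈ absorbed a α := by
  rw [← weylAction_ofCoord a]
  exact weylAction_mem_absorbed a α _ r hr

theorem mono_add_weight_mem_absorbed (u : Fin n → ℤ) (q : Fin N →₀ ℕ)
    (hu : mono u ∈ absorbed a α) : mono (u + weight a q) ∈ absorbed a α := by
  rw [← weylAction_ofPartial_monomial a]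
  exact weylAction_mem_absorbed a α _ _ hu

theorem mono_weight_mem_absorbed (q : Fin N →₀ ℕ) : mono (weight a q) ∈ absorbed a α := by
  rw [← zero_add (weight a q)]
  refine mono_add_weight_mem_absorbed a α 0 q ⟨1, one_mem _, 1, ?_⟩
  simp [mono_zero]

/-! ### Nonresonance and the absorption of all monomials -/

theorem exists_add_weight_eq_weight (ha : AddSubgroup.closure (Set.range a) = ⊤)
    (u : Fin n → ℤ) : ∃ p q, u + weight a q = weight a p := by
  have hu : u ∈ AddSubgroup.closure (Set.range a) := by rw [ha]; trivial
  induction hu using AddSubgroup.closure_induction with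
  | mem x hx =>
    obtain ⟨j, rfl⟩ := hx
    exact ⟨Finsupp.single j 1, 0, by rw [weight_single, map_zero, one_smul, add_zero]⟩
  | zero => exact ⟨0, 0, by simp⟩
  | add x y _ _ hx hy =>
    obtain ⟨p, q, h⟩ := hx
    obtain ⟨p', q', h'⟩ := hy
    exact ⟨p + p', q + q', by rw [map_add, map_add, ← h, ← h']; abel⟩
  | neg x _ hx =>
    obtain ⟨p, q, h⟩ := hx
    exact ⟨q, p, by rw [← h]; abel⟩

/-- The ideal generated by the monomials of exponents `q` such that `x^{u + ∑_j q_j a^{(j)}}` is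
absorbed. -/
def absorbIdeal (u : Fin n → ℤ) : Ideal (MvPolynomial (Fin N) ℂ) :=
  Ideal.span ((fun q => MvPolynomial.monomial q 1) '' {q | mono (u + weight a q) ∈ absorbed a α})

theorem monomial_mem_absorbIdeal (u : Fin n → ℤ) (q : Fin N →₀ ℕ) :
    MvPolynomial.monomial q 1 ∈ absorbIdeal a α u ↔ mono (u + weight a q) ∈ absorbed a α := by
  rw [absorbIdeal, MvPolynomial.mem_ideal_span_monomial_image]
  constructor
  · intro h
    obtain ⟨p, hp, hpq⟩ := h q (by simp [MvPolynomial.support_monomial])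
    have := mono_add_weight_mem_absorbed a α _ (q - p) hp
    rwa [add_assoc, ← map_add, add_tsub_cancel_of_le hpq] at this
  · intro h p hp
    rw [MvPolynomial.support_monomial, if_neg one_ne_zero, Finset.mem_singleton] at hp
    exact ⟨q, h, hp.ge⟩

/-- At a monomial that is not absorbed, chosen with maximal absorbing ideal, some facet form
vanishes at all `a^{(j)}` that do not lead to an absorbed monomial. -/
theorem exists_maximal_not_absorbed (ha : AddSubgroup.closure (Set.range a) = ⊤)
    (h : ∃ u, mono u ∉ absorbed a α) :
    ∃ u, mono u ∉ absorbed a α ∧ ∃ c, IsFacetForm a c ∧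
      ∀ j, mono (u + a j) ∉ absorbed a α → ∑ i, c i * a j i = 0 := by
  classical
  -- Maximal elements exist because the polynomial ring is Noetherian. Passing from u to u + a^{(j)}
  -- can only enlarge the ideal, so it stays the same as long as x^{u + a^{(j)}} is not absorbed.
  obtain ⟨u, hu, hmax⟩ := (InvImage.wf (absorbIdeal a α)
    (wellFounded_gt (α := Ideal (MvPolynomial (Fin N) ℂ)))).has_min
      {u | mono u ∉ absorbed a α} h
  refine ⟨u, hu, ?_⟩
  let J : Finset (Fin N) := Finset.univ.filter fun j => mono (u + a j) ∉ absorbed a α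
  have step : ∀ j ∈ J, ∀ q, mono (u + (a j + weight a q)) ∈ absorbed a α →
      mono (u + weight a q) ∈ absorbed a α := by
    intro j hj q hq
    have hle : absorbIdeal a α u ≤ absorbIdeal a α (u + a j) := by
      refine Ideal.span_le.2 ?_
      rintro _ ⟨q, hq, rfl⟩
      rw [SetLike.mem_coe, monomial_mem_absorbIdeal]
      have := mono_add_weight_mem_absorbed a α _ (Finsupp.single j 1) hq
      rwa [weight_single, one_smul, add_right_comm] at this
    have heq : absorbIdeal a α u = absorbIdeal a α (u + a j) :=
      hle.eq_of_not_lt (hmax _ (Finset.mem_filter.1 hj).2)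
    rwa [← monomial_mem_absorbIdeal, heq, monomial_mem_absorbIdeal, add_assoc]
  have step' : ∀ j ∈ J, ∀ m : ℕ, ∀ q, mono (u + (m • a j + weight a q)) ∈ absorbed a α →
      mono (u + weight a q) ∈ absorbed a α := by
    intro j hj m
    induction m with
    | zero => intro q hq; simpa using hq
    | succ m ih =>
      intro q hq
      refine ih q ?_
      have := step j hj (Finsupp.single j m + q)
      rw [map_add, weight_single] at this
      refine this ?_
      rwa [← add_assoc (a j), ← succ_nsmul']
  -- Because the ideals of u and u + a^{(j)} agree for j ∈ J, steps in the directions of J can be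
  -- cancelled. Nothing in u + ℕJ is therefore absorbed.
  have hface : ∀ (p : Fin N → ℕ), ∀ s ⊆ J, mono (u + ∑ j ∈ s, p j • a j) ∉ absorbed a α := by
    intro p s
    induction s using Finset.induction_on with
    | empty => intro _; simpa using hu
    | insert j s hj ih =>
      intro hs hmem
      have hw : ∑ j ∈ s, p j • a j = weight a (∑ j ∈ s, Finsupp.single j (p j)) := by
        rw [map_sum]
        exact Finset.sum_congr rfl fun j _ => (weight_single a j _).symm
      refine ih (fun k hk => hs (Finset.mem_insert_of_mem hk)) ?_
      rw [hw]
      refine step' j (hs (Finset.mem_insert_self j s)) (p j) _ ?_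
      rwa [Finset.sum_insert hj, hw] at hmem
  -- Some translate of u by an element of ℕA lies in ℕA, since A generates ℤ^n; its monomial is
  -- absorbed, so J is not everything.
  have hne : ∃ k, k ∉ J := by
    by_contra! hall
    obtain ⟨p, q, e⟩ := exists_add_weight_eq_weight a ha u
    refine hface q Finset.univ (fun k _ => hall k) ?_
    rw [← weight_eq_sum, e]
    exact mono_weight_mem_absorbed a α p
  obtain ⟨k, hk⟩ := hne
  -- A positive combination of all the a^{(k)} contains some a^{(k)} with k ∉ J, so adding it to u
  -- gives an absorbed monomial. It cannot be an element of ℕJ.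
  obtain ⟨c, hc, hcJ⟩ := exists_isFacetForm a ha J fun c p hc e => by
    refine hface p J subset_rfl ?_
    have hk' : mono (u + a k) ∈ absorbed a α := by
      by_contra hcon
      exact hk (Finset.mem_filter.2 ⟨Finset.mem_univ k, hcon⟩)
    have := mono_add_weight_mem_absorbed a α _
      (Finsupp.equivFunOnFinite.symm (c - Pi.single k 1)) hk'
    rw [weight_eq_sum] at this
    rw [← e]
    convert this using 2
    rw [add_assoc]
    congr 1
    have h1 : ∑ j, (Pi.single k 1 : Fin N → ℕ) j • a j = a k := by
      rw [Finset.sum_eq_single k] <;> simp +contextual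
    conv_rhs => rw [← h1]
    rw [← Finset.sum_add_distrib]
    refine Finset.sum_congr rfl fun j _ => ?_
    rw [Finsupp.coe_equivFunOnFinite_symm, ← add_smul, Pi.sub_apply, add_tsub_cancel_of_le]
    by_cases hj : j = k
    · subst hj; rw [Pi.single_eq_same]; exact hc j
    · rw [Pi.single_eq_of_ne hj]; exact Nat.zero_le _
  exact ⟨c, hc, fun j hj => hcJ j (Finset.mem_filter.2 ⟨Finset.mem_univ j, hj⟩)⟩

theorem mono_mem_absorbed (ha : AddSubgroup.closure (Set.range a) = ⊤) (hα : Nonresonant a α)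
    (u : Fin n → ℤ) : mono u ∈ absorbed a α := by
  by_contra hcon
  obtain ⟨u, hu, c, hc, hcJ⟩ := exists_maximal_not_absorbed a α ha ⟨u, hcon⟩
  let s : ℂ := ∑ i, (c i : ℂ) * (α i + u i)
  have hs : s ≠ 0 := by
    intro h0
    refine hα c hc (-∑ i, c i * u i) ?_
    simp only [s, mul_add, Finset.sum_add_distrib] at h0
    push_cast
    exact eq_neg_of_add_eq_zero_left h0
  -- The factor s⁻¹ makes T cancel x^u itself. What remains are multiples of the x^{u + a^{(j)}}:
  -- for j with x^{u + a^{(j)}} not absorbed, the coefficient c(a^{(j)}) is zero.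
  refine hu (mem_absorbed_of_unipotent a α (T := 1 - ∑ i, (s⁻¹ * c i) • twistedTheta a α i)
    (Submonoid.subset_closure ⟨_, rfl⟩) _ ?_)
  have e : (∑ i, (s⁻¹ * c i) • twistedTheta a α i) (mono u) = mono u +
      ∑ j, (s⁻¹ * (∑ i, c i * a j i : ℤ)) •
        ((MvPolynomial.X j : Params N) • (mono (u + a j) : Torus n N)) := by
    have h1 : ∀ z : ℂ, (MvPolynomial.C z : Params N) • (mono u : Torus n N) = z • mono u :=
      fun z => by rw [← MvPolynomial.algebraMap_eq, algebraMap_smul]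
    have h2 : ∀ j i, ((a j i : Params N) * MvPolynomial.X j) • (mono (u + a j) : Torus n N) =
        (a j i : ℂ) • (MvPolynomial.X j : Params N) • mono (u + a j) := fun j i => by
      rw [mul_smul, ← algebraMap_smul (Params N) (a j i : ℂ), map_intCast]
    simp only [LinearMap.sum_apply, LinearMap.smul_apply, twistedTheta_mono, h1, h2, smul_add,
      Finset.sum_add_distrib, Finset.smul_sum, smul_smul, ← Finset.sum_smul]
    congr 1
    · simp only [mul_assoc, ← Finset.mul_sum]
      rw [inv_mul_cancel₀ hs, one_smul]
    · rw [Finset.sum_comm]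
      refine Finset.sum_congr rfl fun j _ => ?_
      rw [← Finset.sum_smul]
      congr 1
      push_cast
      rw [Finset.mul_sum]
      exact Finset.sum_congr rfl fun i _ => mul_assoc _ _ _
  rw [LinearMap.sub_apply, Module.End.one_apply, e, sub_add_cancel_left]
  refine neg_mem (sum_mem fun j _ => ?_)
  by_cases hj : mono (u + a j) ∈ absorbed a α
  · exact Submodule.smul_mem _ _ (smul_mem_absorbed a α _ _ hj)
  · rw [hcJ j hj, Int.cast_zero, mul_zero, zero_smul]
    exact zero_mem _

theorem absorbed_eq_top (ha : AddSubgroup.closure (Set.range a) = ⊤) (hα : Nonresonant a α) :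
    absorbed a α = ⊤ := by
  refine eq_top_iff.2 fun r _ => ?_
  induction r using torus_induction with
  | zero => exact zero_mem _
  | add r s hr hs => exact add_mem (hr trivial) (hs trivial)
  | term f u => exact smul_mem_absorbed a α f _ (mono_mem_absorbed a α ha hα u)

/-- The product of the operators found for the single elements works for all of them, as these
operators commute and preserve 𝒟 · 1. -/
theorem exists_unipotent_family (ha : AddSubgroup.closure (Set.range a) = ⊤)
    (hα : Nonresonant a α) {ι : Type*} (s : Finset ι) (r : ι → Torus n N) :
    ∃ T ∈ unipotents a α, ∀ i ∈ s, T (r i) ∈ cyclicPart a := by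
  classical
  induction s using Finset.induction_on with
  | empty => exact ⟨1, one_mem _, by simp⟩
  | insert i s _ ih =>
    obtain ⟨T, hT, h⟩ := ih
    obtain ⟨S, hS, h'⟩ := mem_absorbed.1
      (show r i ∈ absorbed a α by rw [absorbed_eq_top a α ha hα]; trivial)
    refine ⟨T * S, mul_mem hT hS, fun k hk => ?_⟩
    rcases Finset.mem_insert.1 hk with rfl | hk
    · exact (unipotents_sub_mem hT _ (twistedTheta_mem_cyclicPart a α) _ h').1
    · rw [(unipotents_comm hT hS).eq]
      exact (unipotents_sub_mem hS _ (twistedTheta_mem_cyclicPart a α) _ (h k hk)).1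

/-- Modulo `∑_i D_{i,α} R'`, the module `R'` is generated by `1`. -/
theorem exists_sub_weylAction_one (ha : AddSubgroup.closure (Set.range a) = ⊤)
    (hα : Nonresonant a α) (r : Torus n N) :
    ∃ (P : Weyl N) (s : Fin n → Torus n N),
      r = weylAction a P 1 + ∑ i, twistedTheta a α i (s i) := by
  obtain ⟨T, hT, h⟩ := exists_unipotent_family a α ha hα {()} fun _ => r
  obtain ⟨P, hP⟩ := mem_cyclicPart.1 (h () (by simp))
  obtain ⟨-, s, -, hs⟩ := unipotents_sub_mem hT ⊤ (fun _ _ _ => trivial) r trivial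
  exact ⟨P, s, by rw [hP, ← hs]; abel⟩

/-- The elements of the Weyl algebra that annihilate the class of `1` modulo
`∑_i D_{i,α} R'`. -/
theorem mem_hypergeometricIdeal_iff (ha : AddSubgroup.closure (Set.range a) = ⊤)
    (hα : Nonresonant a α) (P : Weyl N) :
    P ∈ hypergeometricIdeal a (-α) ↔
      ∃ s : Fin n → Torus n N, weylAction a P 1 = ∑ i, twistedTheta a α i (s i) := by
  constructor
  · intro hP
    rw [hypergeometricIdeal, Submodule.span_union, Submodule.mem_sup] at hP
    obtain ⟨B, hB, E, hE, rfl⟩ := hP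
    obtain ⟨Q, rfl⟩ := (Submodule.mem_span_range_iff_exists_fun _).1 hE
    refine ⟨fun i => weylAction a (Q i) 1, ?_⟩
    simp only [map_add, LinearMap.add_apply, weylAction_boxIdeal_one a B hB, zero_add, map_sum,
      LinearMap.sum_apply, twistedTheta_weylAction_one, smul_eq_mul]
  · rintro ⟨r, hr⟩
    obtain ⟨T, hT, h⟩ := exists_unipotent_family a α ha hα Finset.univ r
    obtain ⟨-, s, hs, e⟩ := unipotents_sub_mem hT _ (twistedTheta_mem_cyclicPart a α)
      (weylAction a P 1) ⟨P, rfl⟩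
    -- With v = P · 1 this is v = T v + (v - T v). Here T passes through the D_{i,α} onto the r_i,
    -- and v - T v has witnesses s_i in 𝒟 · 1, so all arguments now lie in 𝒟 · 1.
    have e' : weylAction a P 1 = ∑ i, twistedTheta a α i (T (r i) + s i) := by
      rw [sub_eq_iff_eq_add] at e
      rw [e, hr, map_sum, ← Finset.sum_add_distrib]
      refine Finset.sum_congr rfl fun i _ => ?_
      rw [map_add, add_comm, ← Module.End.mul_apply, ← Module.End.mul_apply,
        (commute_of_mem_unipotents hT fun j => twistedTheta_comm a α j i).eq]
    choose Q hQ using fun i => mem_cyclicPart.1 (add_mem (h i (Finset.mem_univ i)) (hs i))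
    have hdiff : P - ∑ i, Q i * eulerOp a (-α) i ∈ boxIdeal a := by
      refine mem_boxIdeal_of_weylAction_one a _ ?_
      simp only [map_sub, map_sum, LinearMap.sub_apply, LinearMap.sum_apply,
        ← twistedTheta_weylAction_one, hQ, e', sub_self]
    rw [← sub_add_cancel P (∑ i, Q i * eulerOp a (-α) i)]
    refine add_mem (Submodule.span_mono Set.subset_union_left hdiff) (sum_mem fun i _ => ?_)
    exact Submodule.smul_mem _ _ (Submodule.subset_span (Or.inr ⟨i, rfl⟩))

end

section

/-! ### Cohomology in top degree -/

/-- The set of all indices, as an index of the basis of `Ω^n`. -/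
def topIndex (n : ℕ) : Set.powersetCard (Fin n) n :=
  Set.powersetCard.ofFinEmbEquiv (RelEmbedding.refl _)

theorem eq_topIndex (I : Set.powersetCard (Fin n) n) : I = topIndex n := by
  have h : ∀ I : Set.powersetCard (Fin n) n, (I : Finset (Fin n)) = Finset.univ := fun I =>
    Finset.eq_univ_of_card _ ((Set.powersetCard.card_eq I).trans (Fintype.card_fin n).symm)
  exact Subtype.ext ((h I).trans (h _).symm)

instance : Unique (Set.powersetCard (Fin n) n) := ⟨⟨topIndex n⟩, eq_topIndex⟩

instance : IsEmpty (Set.powersetCard (Fin n) (n + 1)) := by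
  refine ⟨fun I => ?_⟩
  have := Finset.card_le_univ (I : Finset (Fin n))
  rw [Set.powersetCard.card_eq, Fintype.card_fin] at this
  omega

variable (a : Fin N → Fin n → ℤ) (α : Fin n → ℂ)

instance : Subsingleton (Form a (n + 1)) :=
  (formBasis a (n + 1)).repr.toEquiv.subsingleton

/-- The exterior product of `k` one-forms. -/
def formMulti (k : ℕ) : OneForms n N [⋀^Fin k]→ₗ[Torus n N] Form a k :=
  exteriorPower.ιMulti (Torus n N) k

theorem formBasis_ofFinEmbEquiv (k : ℕ) (f : Fin k ↪o Fin n) :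
    formBasis a k (Set.powersetCard.ofFinEmbEquiv f) = formMulti a k (dlog ∘ f) := by
  change (dlogBasis (n := n) (N := N)).exteriorPower k _ = exteriorPower.ιMulti (Torus n N) k _
  rw [exteriorPower.basis_apply, exteriorPower.ιMulti_family, Equiv.symm_apply_apply]
  congr 1
  ext j : 1
  exact dlogBasis_apply _

theorem formWedge_formMulti (k : ℕ) (η : OneForms n N) (v : Fin k → OneForms n N) :
    formWedge a k η (formMulti a k v) = formMulti a (k + 1) (Fin.cons η v) :=
  wedge_ιMulti k η v

/-- The form `dx_1/x_1 ∧ ⋯ ∧ dx_n/x_n`. -/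
def topForm : Form a n := formBasis a n (topIndex n)

theorem repr_smul_topForm (ω : Form a n) :
    (formBasis a n).repr ω (topIndex n) • topForm a = ω := by
  conv_rhs => rw [← (formBasis a n).sum_repr ω, Fintype.sum_unique]
  rfl

theorem smul_topForm_injective {r s : Torus n N} (h : r • topForm a = s • topForm a) : r = s := by
  have := congrArg (fun ω => (formBasis a n).repr ω (topIndex n)) h
  simpa [topForm] using this

theorem coeffwise_topForm (φ : Module.End ℂ (Torus n N)) (r : Torus n N) :
    coeffwise a n φ (r • topForm a) = φ r • topForm a := by
  rw [coeffwise_apply, Fintype.sum_unique]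
  change φ ((formBasis a n).repr (r • formBasis a n (topIndex n)) (topIndex n)) • topForm a = _
  simp

theorem weyl_smul_topForm (P : Weyl N) : P • topForm a = weylAction a P 1 • topForm a := by
  conv_lhs => rw [← one_smul (Torus n N) (topForm a)]
  rw [weyl_smul_def, coeffwise_topForm]

section Differential

variable {m : ℕ} (b : Fin N → Fin (m + 1) → ℤ) (β : Fin (m + 1) → ℂ)

/-- The permutation `(i, 0, …, i - 1, i + 1, …, m)`. -/
def consPerm (i : Fin (m + 1)) : Equiv.Perm (Fin (m + 1)) :=
  Equiv.ofBijective (Fin.cons i i.succAbove) (Finite.injective_iff_bijective.1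
    (Fin.cons_injective_iff.2 ⟨by simp, Fin.succAbove_right_injective⟩))

/-- The form `dx_1/x_1 ∧ ⋯ ∧ dx_{m+1}/x_{m+1}` without the factor `dx_i/x_i`. -/
def faceForm (i : Fin (m + 1)) : Form b m :=
  formBasis b m (Set.powersetCard.ofFinEmbEquiv (Fin.succAboveOrderEmb i))

theorem formWedge_faceForm (i k : Fin (m + 1)) :
    formWedge b m (dlog k) (faceForm b i) =
      formMulti b (m + 1) (dlog ∘ (Fin.cons k i.succAbove : Fin (m + 1) → Fin (m + 1))) := by
  rw [faceForm, formBasis_ofFinEmbEquiv, formWedge_formMulti]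
  congr 1
  ext j : 1
  exact Fin.cases rfl (fun j => rfl) j

theorem topForm_eq : (topForm b : Form b (m + 1)) = formMulti b (m + 1) dlog :=
  formBasis_ofFinEmbEquiv b (m + 1) _

theorem formWedge_faceForm_self (i : Fin (m + 1)) :
    formWedge b m (dlog i) (faceForm b i) =
      ((Equiv.Perm.sign (consPerm i) : ℤ) : Torus (m + 1) N) • topForm b := by
  rw [formWedge_faceForm, topForm_eq, Int.cast_smul_eq_zsmul]
  exact AlternatingMap.map_perm (formMulti b (m + 1)) dlog (consPerm i)

theorem formWedge_faceForm_of_ne {i k : Fin (m + 1)} (h : k ≠ i) :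
    formWedge b m (dlog k) (faceForm b i) = 0 := by
  obtain ⟨j, rfl⟩ := Fin.exists_succAbove_eq h
  rw [formWedge_faceForm]
  exact (formMulti b (m + 1)).map_eq_zero_of_eq _ (i := 0) (j := j.succ) (by simp)
    (Fin.succ_ne_zero j).symm

theorem nabla_eq_smul_topForm (ω : Form b m) : nabla b β m ω =
    (∑ i, twistedTheta b β i
      ((formBasis b (m + 1)).repr (formWedge b m (dlog i) ω) (topIndex (m + 1)))) •
        topForm b := by
  change nablaHom b β m ω = _
  rw [nablaHom_eq, Finset.sum_smul]
  refine Finset.sum_congr rfl fun i _ => ?_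
  rw [← coeffwise_wedge, ← coeffwise_topForm, repr_smul_topForm]

/-- The wedge of dx_i/x_i with the form omitting it is plus or minus the top form, while the other
dx_k/x_k kill that form. The coefficients of an m-form thus give arbitrary independent arguments for
the D_{i,α}. -/
theorem exists_nabla_eq_iff (η : Form b (m + 1)) :
    (∃ ω, nabla b β m ω = η) ↔
      ∃ s : Fin (m + 1) → Torus (m + 1) N, η = (∑ i, twistedTheta b β i (s i)) • topForm b := by
  constructor
  · rintro ⟨ω, rfl⟩
    exact ⟨_, nabla_eq_smul_topForm b β ω⟩
  · rintro ⟨s, rfl⟩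
    -- The sign is its own inverse and cancels the one from reordering the wedge product.
    let c : Fin (m + 1) → Torus (m + 1) N := fun i =>
      s i * ((Equiv.Perm.sign (consPerm i) : ℤ) : Torus (m + 1) N)
    refine ⟨∑ i, c i • faceForm b i, ?_⟩
    rw [nabla_eq_smul_topForm]
    refine congrArg (· • topForm b) (Finset.sum_congr rfl fun i _ =>
      congrArg (twistedTheta b β i) (smul_topForm_injective b ?_))
    rw [repr_smul_topForm, map_sum, Finset.sum_eq_single i]
    · rw [map_smul, formWedge_faceForm_self, smul_smul, mul_assoc, ← Int.cast_mul,
        ← Units.val_mul, Int.units_mul_self, Units.val_one, Int.cast_one, mul_one]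
    · intro k _ hk
      rw [map_smul, formWedge_faceForm_of_ne b hk.symm, smul_zero]
    · simp

end Differential

/-- The differential of the twisted de Rham complex into the top degree. -/
def dTop : (deRham a α).X ((ComplexShape.up ℕ).prev n) →ₗ[Weyl N] Form a n :=
  ((deRham a α).sc n).f.hom

theorem mem_range_dTop_iff (ω : Form a n) : ω ∈ LinearMap.range (dTop a α) ↔
    ∃ s : Fin n → Torus n N, ω = (∑ i, twistedTheta a α i (s i)) • topForm a := by
  -- The predecessor of n is not definitionally m or 0, so the source degree is made a variable
  -- before it is identified.
  have key : ∀ j, j = (ComplexShape.up ℕ).prev n → (ω ∈ LinearMap.range (dTop a α) ↔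
      ω ∈ LinearMap.range ((deRham a α).d j n).hom) := by
    rintro _ rfl
    rfl
  cases n with
  | zero =>
    -- In degree 0 the predecessor defaults to 0 itself and the differential is zero, in agreement
    -- with the empty sum of the D_{i,α}.
    rw [key 0 (by simp), (deRham a α).shape 0 0 (by simp)]
    constructor
    · rintro ⟨x, rfl⟩
      exact ⟨0, by rw [Finset.univ_eq_empty, Finset.sum_empty, zero_smul]; rfl⟩
    · rintro ⟨s, rfl⟩
      exact ⟨0, by rw [Finset.univ_eq_empty, Finset.sum_empty, zero_smul]; rfl⟩
  | succ m =>
    have hd : (deRham a α).d m (m + 1) = ModuleCat.ofHom (nabla a α m) :=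
      CochainComplex.of_d (fun k => ModuleCat.of (Weyl N) (Form a k))
        (fun k => ModuleCat.ofHom (nabla a α k)) m
    rw [key m (by simp), ← exists_nabla_eq_iff, hd]
    rfl

/-- The cohomology of the twisted de Rham complex in top degree is a cokernel. -/
def topHomologyEquiv :
    (deRham a α).homology n ≃ₗ[Weyl N] Form a n ⧸ LinearMap.range (dTop a α) :=
  -- There are no forms of degree n + 1, so the outgoing differential vanishes and homology is the
  -- whole cokernel of the incoming one.
  (((deRham a α).sc n).asIsoHomologyι (by
    have : Subsingleton ((deRham a α).X ((ComplexShape.up ℕ).next n)) := by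
      rw [CochainComplex.next]
      exact inferInstanceAs (Subsingleton (Form a (n + 1)))
    ext x
    exact Subsingleton.elim (α := (deRham a α).X ((ComplexShape.up ℕ).next n)) _ _) ≪≫
      ((deRham a α).sc n).moduleCatOpcyclesIso).toLinearEquiv

/-- For nonresonant `α`, the `A`-hypergeometric module `ℳ_{-α}` is the cohomology of the twisted
de Rham complex in top degree. -/
theorem nonempty_hypergeometricModule_equiv (ha : AddSubgroup.closure (Set.range a) = ⊤)
    (hα : Nonresonant a α) :
    Nonempty (HypergeometricModule a (-α) ≃ₗ[Weyl N] (deRham a α).homology n) := by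
  let φ : Weyl N →ₗ[Weyl N] Form a n ⧸ LinearMap.range (dTop a α) :=
    (Submodule.mkQ _).comp (LinearMap.toSpanSingleton (Weyl N) (Form a n) (topForm a))
  have hφ : ∀ P, φ P = Submodule.Quotient.mk (weylAction a P 1 • topForm a) := fun P =>
    congrArg Submodule.Quotient.mk (weyl_smul_topForm a P)
  have hker : hypergeometricIdeal a (-α) = LinearMap.ker φ := by
    ext P
    rw [mem_hypergeometricIdeal_iff a α ha hα, LinearMap.mem_ker, hφ,
      Submodule.Quotient.mk_eq_zero, mem_range_dTop_iff]
    exact exists_congr fun s => ⟨fun h => by rw [h], fun h => smul_topForm_injective a h⟩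
  have hsurj : Function.Surjective φ := by
    intro x
    obtain ⟨ω, rfl⟩ := Submodule.Quotient.mk_surjective _ x
    obtain ⟨P, s, h⟩ := exists_sub_weylAction_one a α ha hα
      ((formBasis a n).repr ω (topIndex n))
    refine ⟨P, ?_⟩
    rw [hφ, eq_comm, Submodule.Quotient.eq, mem_range_dTop_iff]
    refine ⟨s, ?_⟩
    rw [← repr_smul_topForm a ω, h, ← sub_smul, add_sub_cancel_left]
  exact ⟨(Submodule.quotEquivOfEq _ _ hker).trans
    ((φ.quotKerEquivOfSurjective hsurj).trans (topHomologyEquiv a α).symm)⟩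

end

end AHypergeometric

end

theorem theorem1p4 {n N : ℕ} (a : Fin N → Fin n → ℤ)
    (ha : AddSubgroup.closure (Set.range a) = ⊤)
    (α : Fin n → ℂ) (hα : AHypergeometric.Nonresonant a α) :
    Nonempty (AHypergeometric.HypergeometricModule a (-α) ≃ₗ[AHypergeometric.Weyl N]
      (AHypergeometric.deRham a α).homology n) :=
  AHypergeometric.nonempty_hypergeometricModule_equiv a α ha hα
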